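/- Let $(M,g_M)$ be a smooth Riemannian manifold, $\varphi\colon M\to(0,\infty)$ a smooth function, $I\subseteq\mathbb R$ an interval, and let $N=M\times_\varphi I$ be the warped product $(M\times I,\ g_M+\varphi\,dr^2)$. Let $\mathcal G_t(x,r)=(x,r+t)$, with Killing field $K=\partial_r=\frac{d}{dt}\mathcal G_t|_{t=0}$. For a smooth function $u\colon\Omega\to I$ on an open set $\Omega\subseteq M$, the graph $\{(x,u(x)):x\in\Omega\}\subset N$ is called a $\mathcal G$-soliton if $H=g(K,\nu)$ along it, where $\nu$ is any local unit normal field of the graph and $H=g(\vec H,\nu)$ is its mean curvature with respect to $\nu$; here $\vec H=\sum_i(\nabla_{e_i}e_i)^\perp$ for tangent orthonormal frames $(e_i)$ and the Levi-Civita connection $\nabla$, so that $H$ is the (unnormalised) trace of the shape operator $v\mapsto-\nabla_v\nu$. Assume that $N$ is submersive, that is: there are an interval $J\subseteq\mathbb R$, smooth functions $\alpha,\widehat\varphi\colon J\to(0,\infty)$ and $h\colon J\to\mathbb R$, and a (surjective) Riemannian submersion $\pi\colon(M,g_M)\to(J,\alpha(s)\,ds^2)$ such that $\varphi=\widehat\varphi\circ\pi$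 and, for every $s\in J$, the fibre $\pi^{-1}(s)$ is a hypersurface of $M$ of constant mean curvature $h(s)$ with respect to the unit normal $-\nabla\pi/\|\nabla\pi\|$. Let $J'\subseteq J$ be an open subinterval, $f\colon J'\to I$ a smooth function, and $u=f\circ\pi\colon\pi^{-1}(J')\to I$. Then the graph of $u$ is a $\mathcal G$-soliton in $N$ if and only if $$f''=\bigl(\alpha+\widehat\varphi\,(f')^2\bigr)\left(1-\frac{\widehat\varphi'\,f'}{2\,\widehat\varphi\,\alpha}-\frac{f'\,h}{\sqrt{\alpha}}\right)+\frac{f'}{2}\left(\log\frac{\alpha}{\widehat\varphi}\right)'\qquad\text{on } J'.$$ -/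

import Mathlib

open Set Filter Topology Manifold Bundle VectorField
open scoped ContDiff

noncomputable section

section General

variable {E : Type*} [NormedAddCommGroup E] [NormedSpace ℝ E]
  {H : Type*} [TopologicalSpace H] {I : ModelWithCorners ℝ E H}
  {X : Type*} [TopologicalSpace X] [ChartedSpace H X]

theorem exists_riemannianGradient [FiniteDimensional ℝ E]
    (g : RiemannianMetric (fun x : X => TangentSpace I x)) (f : X → ℝ) (x : X) :
    ∃ v : TangentSpace I x, ∀ w : TangentSpace I x, g.inner x v w = mvfderiv I f x w := by
  have : FiniteDimensional ℝ (TangentSpace I x) := inferInstanceAs (FiniteDimensional ℝ E)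
  let L : TangentSpace I x →ₗ[ℝ] Module.Dual ℝ (TangentSpace I x) :=
    { toFun := fun v => (g.inner x v).toLinearMap
      map_add' := fun v w => by ext; simp
      map_smul' := fun c v => by ext; simp }
  have hinj : Function.Injective L := by
    rw [injective_iff_map_eq_zero]
    intro v hv
    by_contra hne
    have h1 := g.pos x v hne
    have h2 : g.inner x v v = 0 := LinearMap.congr_fun hv v
    exact h1.ne' h2
  have hsurj : Function.Surjective L :=
    (LinearMap.injective_iff_surjective_of_finrank_eq_finrank
      (Subspace.dual_finrank_eq (K := ℝ) (V := TangentSpace I x)).symm).1 hinj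
  obtain ⟨v, hv⟩ := hsurj (mvfderiv I f x).toLinearMap
  exact ⟨v, fun w => LinearMap.congr_fun hv w⟩

/-- The gradient of `f`: `g(∇f, w) = df(w)` for all tangent vectors `w`. -/
def riemannianGradient (g : RiemannianMetric (fun x : X => TangentSpace I x)) [FiniteDimensional ℝ E]
    (f : X → ℝ) (x : X) : TangentSpace I x :=
  (exists_riemannianGradient g f x).choose

theorem inner_riemannianGradient [FiniteDimensional ℝ E]
    (g : RiemannianMetric (fun x : X => TangentSpace I x)) (f : X → ℝ) (x : X)
    (w : TangentSpace I x) : g.inner x (riemannianGradient g f x) w = mvfderiv I f x w :=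
  (exists_riemannianGradient g f x).choose_spec w

/-- The Koszul expression of three vector fields, that is `2 g(∇_U V, W)` for the Levi-Civita
connection `∇` of `g`. -/
def koszul (g : RiemannianMetric (fun x : X => TangentSpace I x))
    (U V W : Π x : X, TangentSpace I x) (p : X) : ℝ :=
  mvfderiv I (fun q => g.inner q (V q) (W q)) p (U p)
    + mvfderiv I (fun q => g.inner q (U q) (W q)) p (V p)
    - mvfderiv I (fun q => g.inner q (U q) (V q)) p (W p)
    + g.inner p (mlieBracket I U V p) (W p)
    - g.inner p (mlieBracket I U W p) (V p)
    - g.inner p (mlieBracket I V W p) (U p)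

variable [IsManifold I 1 X]

/-- The number `g(∇_v Y, w)`, where `∇` is the Levi-Civita connection of `g`, `v` and `w` are
tangent vectors at `p` and `Y` is a vector field that is smooth near `p`. It is given by
the Koszul formula, applied to local extensions of `v` and `w` (constant in the preferred chart
at `p`); the value does not depend on the extensions. -/
def leviCivita (g : RiemannianMetric (fun x : X => TangentSpace I x)) {p : X}
    (v : TangentSpace I p) (Y : Π x : X, TangentSpace I x) (w : TangentSpace I p) : ℝ :=
  (1 / 2) * koszul g (FiberBundle.extend E v) Y (FiberBundle.extend E w) p

/-- The mean curvature at `p`, with respect to `ν`, of a hypersurface through `p`, where `ν` is a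
vector field, smooth near `p`, whose restriction to the hypersurface is a unit normal field. It is
the trace of the shape operator `v ↦ -∇_v ν` over the tangent space `ν(p)^⊥` of the hypersurface,
which equals `∑ i, g(∇_{e i} e i, ν)` for tangent orthonormal frames `e` (not normalised by the
dimension). It depends only on the restriction of `ν` to the hypersurface. -/
def meanCurvature [FiniteDimensional ℝ E] (g : RiemannianMetric (fun x : X => TangentSpace I x))
    (ν : Π x : X, TangentSpace I x) (p : X) : ℝ :=
  letI : RiemannianBundle (fun x : X => TangentSpace I x) := ⟨g⟩
  haveI : FiniteDimensional ℝ (TangentSpace I p) := inferInstanceAs (FiniteDimensional ℝ E)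
  let b := stdOrthonormalBasis ℝ ((Submodule.span ℝ {ν p})ᗮ : Submodule ℝ (TangentSpace I p))
  ∑ i, -leviCivita g (b i : TangentSpace I p) ν (b i : TangentSpace I p)

end General

section Warped

variable {E : Type*} [NormedAddCommGroup E] [NormedSpace ℝ E]
  {H : Type*} [TopologicalSpace H] {I : ModelWithCorners ℝ E H}
  {M : Type*} [TopologicalSpace M] [ChartedSpace H M]

/-- The bilinear form `((v, a), (w, b)) ↦ g(v, w) + c a b` on `T_x M × ℝ`. -/
def warpedForm (g : RiemannianMetric (fun x : M => TangentSpace I x)) (c : ℝ) (p : M × ℝ) :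
    TangentSpace (I.prod 𝓘(ℝ, ℝ)) p →L[ℝ] TangentSpace (I.prod 𝓘(ℝ, ℝ)) p →L[ℝ] ℝ :=
  let G : E →L[ℝ] E →L[ℝ] ℝ := g.inner p.1
  let B : (E × ℝ) →L[ℝ] (E × ℝ) →L[ℝ] ℝ :=
    G.bilinearComp (ContinuousLinearMap.fst ℝ E ℝ) (ContinuousLinearMap.fst ℝ E ℝ)
      + c • (ContinuousLinearMap.mul ℝ ℝ).bilinearComp
          (ContinuousLinearMap.snd ℝ E ℝ) (ContinuousLinearMap.snd ℝ E ℝ)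
  B

theorem warpedForm_apply (g : RiemannianMetric (fun x : M => TangentSpace I x)) (c : ℝ)
    (p : M × ℝ) (v w : E) (a b : ℝ) :
    warpedForm g c p ((v, a) : E × ℝ) ((w, b) : E × ℝ) = g.inner p.1 v w + c * (a * b) := by
  rfl

/-- The warped product metric `g + φ dr²` on `M × ℝ`. -/
def warpedMetric (g : RiemannianMetric (fun x : M => TangentSpace I x)) (φ : M → ℝ)
    (hφ : ∀ x, 0 < φ x) :
    RiemannianMetric (fun p : M × ℝ => TangentSpace (I.prod 𝓘(ℝ, ℝ)) p) where
  inner p := warpedForm g (φ p.1) p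
  symm := by
    rintro p ⟨v, a⟩ ⟨w, b⟩
    exact (congrArg₂ (· + ·) (g.symm p.1 v w) (congrArg (φ p.1 * ·) (mul_comm a b)))
  pos := by
    rintro p ⟨v, a⟩ hv
    change 0 < g.inner p.1 v v + φ p.1 * (a * a)
    have hc := hφ p.1
    by_cases h1 : v = 0
    · have h2 : a ≠ 0 := fun h2 => hv (Prod.ext h1 h2)
      have h3 : g.inner p.1 v v = 0 := by
        rw [h1]; exact congrArg (fun L => L (0 : E)) (map_zero (g.inner p.1))
      rw [h3, zero_add]
      exact mul_pos hc (mul_self_pos.2 h2)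
    · have h3 := g.pos p.1 v h1
      have h4 := mul_nonneg hc.le (mul_self_nonneg a)
      linarith
  continuousAt p := by
    let B : (E × ℝ) →L[ℝ] (E × ℝ) →L[ℝ] ℝ := warpedForm g (φ p.1) p
    have h : Continuous (fun v : E × ℝ => B v v) := B.continuous.clm_apply continuous_id
    exact h.continuousAt
  isVonNBounded p := by
    have hc := hφ p.1
    have h1 : Bornology.IsVonNBounded ℝ {v : E | g.inner p.1 v v < 1} := g.isVonNBounded p.1
    have h2 : Bornology.IsVonNBounded ℝ {a : ℝ | φ p.1 * (a * a) < 1} := by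
      rw [NormedSpace.isVonNBounded_iff']
      refine ⟨1 + (φ p.1)⁻¹, fun a ha => ?_⟩
      have ha' : a * a < (φ p.1)⁻¹ := by
        rw [← one_div, lt_div_iff₀ hc]; linarith [mul_comm (φ p.1) (a * a), ha.out]
      rw [Real.norm_eq_abs]
      have := abs_mul_abs_self a
      nlinarith [sq_nonneg (|a| - 1), abs_nonneg a]
    rw [NormedSpace.isVonNBounded_iff'] at h1 h2
    obtain ⟨r1, h1⟩ := h1
    obtain ⟨r2, h2⟩ := h2
    have key : Bornology.IsVonNBounded ℝ
        {v : E × ℝ | g.inner p.1 v.1 v.1 + φ p.1 * (v.2 * v.2) < 1} := by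
      rw [NormedSpace.isVonNBounded_iff']
      refine ⟨max r1 r2, ?_⟩
      rintro ⟨v, a⟩ hv
      have hv' : g.inner p.1 v v + φ p.1 * (a * a) < 1 := hv
      have h4 := mul_nonneg hc.le (mul_self_nonneg a)
      have h5 : 0 ≤ g.inner p.1 v v := by
        by_cases h : v = 0
        · rw [h]; exact (congrArg (fun L => L (0 : E)) (map_zero (g.inner p.1))).ge
        · exact (g.pos p.1 v h).le
      refine max_le_max (h1 v ?_) (h2 a ?_)
      · change g.inner p.1 v v < 1; linarith
      · change φ p.1 * (a * a) < 1; linarith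
    exact key

/-- The flow `𝒢_t (x, r) = (x, r + t)`. -/
def verticalFlow (t : ℝ) (p : M × ℝ) : M × ℝ := (p.1, p.2 + t)

variable (I) in
/-- The vector field `K(p) = d/dt 𝒢_t(p)` at `t = 0` generated by the vertical flow. -/
def killingField (p : M × ℝ) : TangentSpace (I.prod 𝓘(ℝ, ℝ)) p :=
  (mfderiv 𝓘(ℝ, ℝ) (I.prod 𝓘(ℝ, ℝ)) (fun t : ℝ => verticalFlow t p) 0 (1 : ℝ) : E × ℝ)

/-- `ν` is, near `x`, a unit normal field along the map `F : M → N` (with `N` carrying the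
metric `g`), and extends smoothly to a neighbourhood of `F x` in `N`. -/
structure IsLocalUnitNormal {E' : Type*} [NormedAddCommGroup E'] [NormedSpace ℝ E']
    {H' : Type*} [TopologicalSpace H'] {I' : ModelWithCorners ℝ E' H'}
    {N : Type*} [TopologicalSpace N] [ChartedSpace H' N] [IsManifold I' 1 N]
    (I : ModelWithCorners ℝ E H) (g : RiemannianMetric (fun y : N => TangentSpace I' y))
    (F : M → N) (x : M) (ν : Π y : N, TangentSpace I' y) : Prop where
  smooth : ContMDiffAt I' I'.tangent ∞ (fun y => (⟨y, ν y⟩ : TangentBundle I' N)) (F x)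
  unit : ∀ᶠ z in 𝓝 x, g.inner (F z) (ν (F z)) (ν (F z)) = 1
  normal : ∀ᶠ z in 𝓝 x, ∀ w : TangentSpace I z, g.inner (F z) (ν (F z)) (mfderiv I I' F z w) = 0

/-- The graph of `u : Ω → ℝ`, as a hypersurface of `M × ℝ` with the metric `g + φ dr²`, is a
soliton for the flow `𝒢_t (x, r) = (x, r + t)`: its mean curvature satisfies `H = g(K, ν)`, for
all (local) unit normal fields `ν`. If `u` takes values in an interval `I₀`, the graph lies in the
warped product `M ×_φ I₀`, which is the part `M × I₀` of `M × ℝ` with the same metric; as mean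
curvature is local, it may be computed in `M × ℝ`. -/
def IsGraphSoliton [FiniteDimensional ℝ E] [IsManifold I 1 M]
    (g : RiemannianMetric (fun x : M => TangentSpace I x)) (φ : M → ℝ)
    (hφ : ∀ x, 0 < φ x) (Ω : Set M) (u : M → ℝ) : Prop :=
  ∀ x ∈ Ω, ∀ ν : Π p : M × ℝ, TangentSpace (I.prod 𝓘(ℝ, ℝ)) p,
    IsLocalUnitNormal I (warpedMetric g φ hφ) (fun z => (z, u z)) x ν →
    meanCurvature (warpedMetric g φ hφ) ν (x, u x) =
      (warpedMetric g φ hφ).inner (x, u x) (killingField I (x, u x)) (ν (x, u x))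

/-- `proj` is a Riemannian submersion from `(M, g)` onto the interval `J` with the metric
`α(s) ds²`: a smooth map onto `J` with surjective differentials, which are isometric on the
orthogonal complements of their kernels. -/
structure IsRiemannianSubmersionOnto (g : RiemannianMetric (fun x : M => TangentSpace I x))
    (proj : M → ℝ) (J : Set ℝ) (α : ℝ → ℝ) : Prop where
  smooth : ContMDiff I 𝓘(ℝ, ℝ) ∞ proj
  range_eq : range proj = J
  surjective : ∀ x, Function.Surjective (mvfderiv I proj x)
  isometric : ∀ x, ∀ v : TangentSpace I x,
    (∀ w : TangentSpace I x, mvfderiv I proj x w = 0 → g.inner x v w = 0) →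
      g.inner x v v = α (proj x) * (mvfderiv I proj x v * mvfderiv I proj x v)

/-- The unit vector field `-∇proj / ‖∇proj‖`. -/
def fibreNormal [FiniteDimensional ℝ E] (g : RiemannianMetric (fun x : M => TangentSpace I x))
    (proj : M → ℝ) (x : M) : TangentSpace I x :=
  -((√(g.inner x (riemannianGradient g proj x) (riemannianGradient g proj x)))⁻¹
    • riemannianGradient g proj x)

/-- The warped product of `(M, g)` and an interval with warping function `φ` is submersive, through
the Riemannian submersion `proj : (M, g) → (J, α ds²)`, with `φ = φhat ∘ proj` and with fibres
`proj⁻¹(s)`, for `s` in `J`, of constant mean curvature `h s` with respect to `-∇proj / ‖∇proj‖`. -/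
structure IsSubmersive [FiniteDimensional ℝ E] [IsManifold I 1 M]
    (g : RiemannianMetric (fun x : M => TangentSpace I x)) (φ : M → ℝ)
    (proj : M → ℝ) (J : Set ℝ) (α φhat h : ℝ → ℝ) : Prop where
  ordConnected : J.OrdConnected
  alpha_pos : ∀ s ∈ J, 0 < α s
  alpha_smooth : ContDiffOn ℝ ∞ α J
  submersion : IsRiemannianSubmersionOnto g proj J α
  phi_smooth : ContDiffOn ℝ ∞ φhat J
  phi_eq : ∀ x, φ x = φhat (proj x)
  h_smooth : ContDiffOn ℝ ∞ h J
  fibres : ∀ s ∈ J, ∀ x, proj x = s → meanCurvature g (fibreNormal g proj) x = h s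

end Warped

end

/-!
For a unit normal field `ν` along a hypersurface, the mean curvature is minus the trace of the
quadratic form `v ↦ g(∇_v ν, v)` over `ν^⊥`. On the diagonal the Koszul formula collapses: in a
chart, `g(∇_v Y, v)` is half the derivative of the metric along `Y`, evaluated at `(v, v)`, plus
`g(DY v, v)` (`leviCivita_self_eq`). This form is called `nablaForm` below, and it is all that is
needed of the Levi-Civita connection.

Let `π` be the submersion `proj` and `P = ∇π`; write `φ` also for `φhat`, so that primes are
derivatives with respect to `s ∈ J`. Since `π` is a Riemannian submersion onto
`(J, α ds²)`, `g(P, P) = 1 / α` (`IsRiemannianSubmersionOnto.inner_gradient_self`). Differentiating along `P` gives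
`g(∇_P P, P) = -α' / (2 α³)`, and splitting `tr ∇P` into the direction of `P` and its complement
expresses the mean curvature `h` of the fibres: `h = √α (tr ∇P + α' / (2 α²))`
(`IsSubmersive.fibre_meanCurvature_eq`).

In the warped product, let `ν = (X₁, X₂)` be a unit normal field along the graph of `u = f ∘ π` and
put `b = φ X₂`, which equals `g(K, ν)`. Orthogonality to the graph means `X₁ = -b f' P`, and
`|ν| = 1` means `b² (f'² / α + 1 / φ) = 1`; in particular `b ≠ 0`. Tangent vectors of the graph are
`v = (w, f' dπ(w))`, and with `κ = f'' + φ' f'³ / (2 α) + φ' f' / φ`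
(`leviCivita_warpedMetric_graph_comp`),

  `-g(∇_v ν, v) = b (f' g(∇_w P, w) + κ dπ(w)²)`.

The right-hand side depends only on the component `w` of `v` along `M`, and `v ↦ w` is a
coisometry `T N → T M`, so the trace over `ν^⊥` is the trace over `T M` minus the value at `X₁`
(`meanCurvature_eq_metricTrace`). Everything is now expressed by `α`, `φ`, `f` and `h`; dividing
`H = g(K, ν)` by `b` and clearing denominators gives the differential equation
(`soliton_algebra`). This settles the equivalence at each point for each unit normal field
(`IsSubmersive.meanCurvature_graph_eq_iff`). To deduce the equation from the soliton property,
it remains that a smooth unit normal field exists near every point of the graph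
(`IsSubmersive.exists_isLocalUnitNormal_graph`), which uses that the gradient of a smooth function
is smooth (`ContMDiffAt.riemannianGradient`), and that `π` is onto `J`.
-/

noncomputable section

/-! ### Traces over the orthogonal complement of a vector -/

section Trace

variable {V W : Type*} [NormedAddCommGroup V] [InnerProductSpace ℝ V] [FiniteDimensional ℝ V]
  [NormedAddCommGroup W] [InnerProductSpace ℝ W] [FiniteDimensional ℝ W]

/-- The orthogonal projection of `a` onto `ν^⊥`, expanded in an orthonormal basis. -/
theorem sum_inner_smul_stdOrthonormalBasis_orthogonal (ν a : V) :
    ∑ i, inner ℝ a (stdOrthonormalBasis ℝ (ℝ ∙ ν)ᗮ i : V) • (stdOrthonormalBasis ℝ (ℝ ∙ ν)ᗮ i : V)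
      = a - (inner ℝ ν a / inner ℝ ν ν) • ν := by
  have h1 := (stdOrthonormalBasis ℝ (ℝ ∙ ν)ᗮ).starProjection_eq_sum_rankOne
  have h2 : (ℝ ∙ ν)ᗮ.starProjection a = a - (inner ℝ ν a / inner ℝ ν ν) • ν := by
    rw [Submodule.starProjection_orthogonal_val, Submodule.starProjection_singleton]
    simp
  rw [← h2, h1]
  simp [real_inner_comm]

/-- If `A : V → W` is a coisometry, with adjoint `A'`, then the trace over `ν^⊥` of the pullback of
a bilinear form `S` by `A` is the trace of `S` minus the value of the pullback on the normalised
`ν`. With `A = id` this is the trace over a hyperplane; for hypersurfaces in a product, `A` is the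
projection to a factor. -/
theorem sum_bilin_stdOrthonormalBasis_orthogonal (ν : V) (A : V →ₗ[ℝ] W)
    (A' : W → V) (hadj : ∀ w v, inner ℝ (A' w) v = inner ℝ w (A v)) (hA : ∀ w, A (A' w) = w)
    (S : W →ₗ[ℝ] W →ₗ[ℝ] ℝ) :
    ∑ i, S (A (stdOrthonormalBasis ℝ (ℝ ∙ ν)ᗮ i : V)) (A (stdOrthonormalBasis ℝ (ℝ ∙ ν)ᗮ i : V))
      = ∑ k, S (stdOrthonormalBasis ℝ W k) (stdOrthonormalBasis ℝ W k)
        - S (A ν) (A ν) / inner ℝ ν ν := by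
  set x := stdOrthonormalBasis ℝ W
  have hS : ∀ w w' : W, S w w' = ∑ k, inner ℝ (x k) w * S (x k) w' := by
    intro w w'
    conv_lhs => rw [← x.sum_repr' w]
    simp
  have key : ∀ k, ∑ i, inner ℝ (x k) (A (stdOrthonormalBasis ℝ (ℝ ∙ ν)ᗮ i : V))
      * S (x k) (A (stdOrthonormalBasis ℝ (ℝ ∙ ν)ᗮ i : V))
      = S (x k) (x k) - inner ℝ (x k) (A ν) * S (x k) (A ν) / inner ℝ ν ν := by
    intro k
    have h := congrArg (fun v => S (x k) (A v))
      (sum_inner_smul_stdOrthonormalBasis_orthogonal ν (A' (x k)))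
    simp only [map_sum, map_smul, map_sub, smul_eq_mul, hA, hadj] at h
    rw [h, real_inner_comm, hadj]
    ring
  simp_rw [hS (A _) (A _)]
  rw [Finset.sum_comm, Finset.sum_div, ← Finset.sum_sub_distrib]
  exact Finset.sum_congr rfl fun k _ => key k

end Trace

/-! ### Vector fields and metrics in a chart, and the Koszul formula -/

section Coordinates

variable {E : Type*} [NormedAddCommGroup E] [NormedSpace ℝ E]
  {H : Type*} [TopologicalSpace H] {I : ModelWithCorners ℝ E H}
  {X : Type*} [TopologicalSpace X] [ChartedSpace H X]

/-- The trace of a bilinear form on `T_p X` with respect to the metric `g`. -/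
def metricTrace [FiniteDimensional ℝ E] (g : RiemannianMetric (fun x : X => TangentSpace I x))
    (p : X) (S : TangentSpace I p →L[ℝ] TangentSpace I p →L[ℝ] ℝ) : ℝ :=
  letI : RiemannianBundle (fun x : X => TangentSpace I x) := ⟨g⟩
  haveI : FiniteDimensional ℝ (TangentSpace I p) := inferInstanceAs (FiniteDimensional ℝ E)
  ∑ k, S (stdOrthonormalBasis ℝ (TangentSpace I p) k) (stdOrthonormalBasis ℝ (TangentSpace I p) k)

theorem metricTrace_add [FiniteDimensional ℝ E]
    (g : RiemannianMetric (fun x : X => TangentSpace I x))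
    (p : X) (S T : TangentSpace I p →L[ℝ] TangentSpace I p →L[ℝ] ℝ) :
    metricTrace g p (S + T) = metricTrace g p S + metricTrace g p T := by
  simp [metricTrace, Finset.sum_add_distrib]

theorem metricTrace_smul [FiniteDimensional ℝ E]
    (g : RiemannianMetric (fun x : X => TangentSpace I x))
    (p : X) (c : ℝ) (S : TangentSpace I p →L[ℝ] TangentSpace I p →L[ℝ] ℝ) :
    metricTrace g p (c • S) = c * metricTrace g p S := by
  simp [metricTrace, Finset.mul_sum]

theorem metricTrace_smulRight [FiniteDimensional ℝ E]
    (g : RiemannianMetric (fun x : X => TangentSpace I x))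
    (p : X) (v : TangentSpace I p) :
    metricTrace g p ((g.inner p v).smulRight (g.inner p v)) = g.inner p v v := by
  let : RiemannianBundle (fun x : X => TangentSpace I x) := ⟨g⟩
  have : FiniteDimensional ℝ (TangentSpace I p) := inferInstanceAs (FiniteDimensional ℝ E)
  have h := (stdOrthonormalBasis ℝ (TangentSpace I p)).sum_inner_mul_inner v v
  refine Eq.trans (Finset.sum_congr rfl fun k _ => ?_) h
  rw [real_inner_comm v]
  rfl

theorem mvfderiv_congr_of_eventuallyEq {F : Type*} [NormedAddCommGroup F] [NormedSpace ℝ F]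
    {f f' : X → F} {p : X} (h : f =ᶠ[𝓝 p] f') : mvfderiv I f p = mvfderiv I f' p := by
  ext v
  exact congrArg (fun L : E →L[ℝ] F => L v) h.mfderiv_eq

theorem lieBracketWithin_eq_of_eventuallyEq_const {V W W' : E → E} {s : Set E} {x v : E}
    (hV : V =ᶠ[𝓝[s] x] fun _ => v) (hVx : V x = v) (hW : W =ᶠ[𝓝[s] x] W') (hWx : W x = W' x) :
    lieBracketWithin ℝ V W s x = fderivWithin ℝ W' s x v := by
  rw [lieBracketWithin, hV.fderivWithin_eq hVx, hW.fderivWithin_eq hWx, hVx]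
  simp

variable [IsManifold I 1 X]

/-- The mean curvature with respect to `ν`, when the shape operator is the pullback of a bilinear
form `S` by a coisometry `A` with adjoint `A'`. The form `S` has to represent the shape operator
only on `ν^⊥`. -/
theorem meanCurvature_eq_metricTrace [FiniteDimensional ℝ E]
    {E' : Type*} [NormedAddCommGroup E'] [NormedSpace ℝ E'] [FiniteDimensional ℝ E']
    {H' : Type*} [TopologicalSpace H'] {I' : ModelWithCorners ℝ E' H'}
    {Y : Type*} [TopologicalSpace Y] [ChartedSpace H' Y]
    (g : RiemannianMetric (fun x : X => TangentSpace I x))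
    (g' : RiemannianMetric (fun y : Y => TangentSpace I' y))
    (ν : Π x : X, TangentSpace I x) (p : X) (y : Y)
    (A : TangentSpace I p →L[ℝ] TangentSpace I' y) (A' : TangentSpace I' y → TangentSpace I p)
    (hadj : ∀ w v, g.inner p (A' w) v = g'.inner y w (A v)) (hA : ∀ w, A (A' w) = w)
    (S : TangentSpace I' y →L[ℝ] TangentSpace I' y →L[ℝ] ℝ)
    (hS : ∀ v, g.inner p (ν p) v = 0 → -leviCivita g v ν v = S (A v) (A v)) :
    meanCurvature g ν p =
      metricTrace g' y S - S (A (ν p)) (A (ν p)) / g.inner p (ν p) (ν p) := by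
  let : RiemannianBundle (fun x : X => TangentSpace I x) := ⟨g⟩
  let : RiemannianBundle (fun x : Y => TangentSpace I' x) := ⟨g'⟩
  have : FiniteDimensional ℝ (TangentSpace I p) := inferInstanceAs (FiniteDimensional ℝ E)
  have : FiniteDimensional ℝ (TangentSpace I' y) := inferInstanceAs (FiniteDimensional ℝ E')
  let S' : TangentSpace I' y →ₗ[ℝ] TangentSpace I' y →ₗ[ℝ] ℝ :=
    LinearMap.mk₂ ℝ (fun v w => S v w) (by simp) (by simp) (by simp) (by simp)
  refine Eq.trans ?_
    (sum_bilin_stdOrthonormalBasis_orthogonal (ν p) A.toLinearMap A' hadj hA S')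
  refine Finset.sum_congr rfl fun i _ => hS _ ?_
  exact Submodule.mem_orthogonal_singleton_iff_inner_right.1
    (stdOrthonormalBasis ℝ (ℝ ∙ ν p)ᗮ i).2

variable (I) in
/-- The coordinates of the vector field `Y` in the trivialization of the tangent bundle given by
the preferred chart at `p`. -/
def fieldInChart (p : X) (Y : Π x : X, TangentSpace I x) (q : X) : E :=
  (trivializationAt E (TangentSpace I) p).continuousLinearMapAt ℝ q (Y q)

/-- The metric `g` in the trivialization of the tangent bundle given by the preferred chart
at `p`. -/
def metricInChart (g : RiemannianMetric (fun x : X => TangentSpace I x)) (p q : X) :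
    E →L[ℝ] E →L[ℝ] ℝ :=
  let G : E →L[ℝ] E →L[ℝ] ℝ := g.inner q
  let e : E →L[ℝ] E := (trivializationAt E (TangentSpace I) p).symmL ℝ q
  G.bilinearComp e e

theorem continuousLinearMapAt_trivializationAt_self (p : X) (v : TangentSpace I p) :
    (trivializationAt E (TangentSpace I) p).continuousLinearMapAt ℝ p v = v := by
  rw [TangentBundle.continuousLinearMapAt_trivializationAt_eq_core (mem_chart_source H p)]
  exact (tangentBundleCore I X).coordChange_self (achart H p) p (mem_chart_source H p) v

theorem fieldInChart_self (p : X) (Y : Π x : X, TangentSpace I x) : fieldInChart I p Y p = Y p :=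
  continuousLinearMapAt_trivializationAt_self p (Y p)

theorem symmL_fieldInChart {p q : X} (hq : q ∈ (trivializationAt E (TangentSpace I) p).baseSet)
    (Y : Π x : X, TangentSpace I x) :
    (trivializationAt E (TangentSpace I) p).symmL ℝ q (fieldInChart I p Y q) = Y q :=
  (trivializationAt E (TangentSpace I) p).symmL_continuousLinearMapAt hq (Y q)

theorem extend_eq_symmL {p q : X} (hq : q ∈ (trivializationAt E (TangentSpace I) p).baseSet)
    (v : TangentSpace I p) :
    FiberBundle.extend E v q = (trivializationAt E (TangentSpace I) p).symmL ℝ q (v : E) := by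
  have h : (trivializationAt E (TangentSpace I) p ⟨p, v⟩).2 = (v : E) := by
    rw [← (trivializationAt E (TangentSpace I) p).continuousLinearMapAt_apply_of_mem (R := ℝ)
      (FiberBundle.mem_baseSet_trivializationAt' p)]
    exact continuousLinearMapAt_trivializationAt_self p v
  rw [FiberBundle.extend, h]
  exact ((trivializationAt E (TangentSpace I) p).symmL_apply hq v).symm

theorem metricInChart_apply (g : RiemannianMetric (fun x : X => TangentSpace I x)) {p q : X}
    (hq : q ∈ (trivializationAt E (TangentSpace I) p).baseSet) (v w : TangentSpace I p) :
    metricInChart g p q v w = g.inner q (FiberBundle.extend E v q) (FiberBundle.extend E w q) := by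
  rw [extend_eq_symmL hq, extend_eq_symmL hq]
  rfl

theorem metricInChart_fieldInChart (g : RiemannianMetric (fun x : X => TangentSpace I x))
    {p q : X} (hq : q ∈ (trivializationAt E (TangentSpace I) p).baseSet)
    (Y Z : Π x : X, TangentSpace I x) :
    metricInChart g p q (fieldInChart I p Y q) (fieldInChart I p Z q) = g.inner q (Y q) (Z q) := by
  refine Eq.trans ?_ (congrArg₂ (fun a b => g.inner q a b) (symmL_fieldInChart hq Y)
    (symmL_fieldInChart hq Z))
  rfl

theorem metricInChart_self (g : RiemannianMetric (fun x : X => TangentSpace I x)) (p : X) :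
    metricInChart g p p = g.inner p := by
  ext v w
  exact (metricInChart_apply g (FiberBundle.mem_baseSet_trivializationAt' p) v w).trans
    (congrArg₂ (fun a b => g.inner p a b)
      (FiberBundle.extend_apply_self (E := fun x : X => TangentSpace I x) E v)
      (FiberBundle.extend_apply_self (E := fun x : X => TangentSpace I x) E w))

theorem mdifferentiableAt_fieldInChart {p : X} {Y : Π x : X, TangentSpace I x}
    (hY : MDifferentiableAt I I.tangent (fun x => (⟨x, Y x⟩ : TangentBundle I X)) p) :
    MDifferentiableAt I 𝓘(ℝ, E) (fieldInChart I p Y) p := by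
  refine ((mdifferentiableAt_section _ Y).1 hY).congr_of_eventuallyEq ?_
  filter_upwards [chart_source_mem_nhds H p] with q hq
  exact (trivializationAt E (TangentSpace I) p).continuousLinearMapAt_apply_of_mem ℝ hq (Y q)

theorem fieldInChart_extend {p q : X} (hq : q ∈ (trivializationAt E (TangentSpace I) p).baseSet)
    (v : TangentSpace I p) : fieldInChart I p (FiberBundle.extend E v) q = v := by
  rw [fieldInChart, extend_eq_symmL hq]
  exact (trivializationAt E (TangentSpace I) p).continuousLinearMapAt_symmL hq (v : E)

/-- The pullback of a vector field to the model space by the inverse chart is given by its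
coordinates in the trivialization of the tangent bundle. -/
theorem mpullbackWithin_extChartAt_symm_eq {p : X} {y : E} (hy : y ∈ (extChartAt I p).target)
    (Y : Π x : X, TangentSpace I x) :
    mpullbackWithin 𝓘(ℝ, E) I (extChartAt I p).symm Y (range I) y =
      fieldInChart I p Y ((extChartAt I p).symm y) := by
  have hq : (extChartAt I p).symm y ∈ (chartAt H p).source := by
    rw [← extChartAt_source I]
    exact (extChartAt I p).map_target hy
  rw [mpullbackWithin_apply, fieldInChart,
    ContinuousLinearMap.inverse_eq
      (mfderivWithin_extChartAt_symm_comp_mfderiv_extChartAt hy)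
      (mfderiv_extChartAt_comp_mfderivWithin_extChartAt_symm hy),
    TangentBundle.continuousLinearMapAt_trivializationAt hq]
  rfl

/-- The field `FiberBundle.extend E v` is constant in the chart, so that only the derivative
of `Y` survives in the Lie bracket. -/
theorem mlieBracket_extend {p : X} (v : TangentSpace I p) {Y : Π x : X, TangentSpace I x}
    (hY : MDifferentiableAt I I.tangent (fun x => (⟨x, Y x⟩ : TangentBundle I X)) p) :
    mlieBracket I (FiberBundle.extend E v) Y p = mvfderiv I (fieldInChart I p Y) p v := by
  have hlin : lieBracketWithin ℝ
      (mpullbackWithin 𝓘(ℝ, E) I (extChartAt I p).symm (FiberBundle.extend E v) (range I))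
      (mpullbackWithin 𝓘(ℝ, E) I (extChartAt I p).symm Y (range I))
      ((extChartAt I p).symm ⁻¹' univ ∩ range I) (extChartAt I p p) =
      mvfderiv I (fieldInChart I p Y) p v := by
    have hmem := mem_extChartAt_target (I := I) p
    have hev : ∀ᶠ y in 𝓝[range I] (extChartAt I p p), y ∈ (extChartAt I p).target :=
      extChartAt_target_mem_nhdsWithin p
    have hbase : ∀ y ∈ (extChartAt I p).target,
        (extChartAt I p).symm y ∈ (trivializationAt E (TangentSpace I) p).baseSet := by
      intro y hy
      rw [TangentBundle.trivializationAt_baseSet, ← extChartAt_source I]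
      exact (extChartAt I p).map_target hy
    have hV : ∀ y ∈ (extChartAt I p).target,
        mpullbackWithin 𝓘(ℝ, E) I (extChartAt I p).symm (FiberBundle.extend E v) (range I) y
          = (v : E) := fun y hy =>
      (mpullbackWithin_extChartAt_symm_eq hy _).trans (fieldInChart_extend (hbase y hy) v)
    rw [preimage_univ, univ_inter]
    refine (lieBracketWithin_eq_of_eventuallyEq_const
      (W' := fun y => fieldInChart I p Y ((extChartAt I p).symm y)) (hev.mono hV) (hV _ hmem)
      (hev.mono fun y hy => mpullbackWithin_extChartAt_symm_eq hy Y)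
      (mpullbackWithin_extChartAt_symm_eq hmem Y)).trans ?_
    exact congrArg (fun L : E →L[ℝ] E => L v) (mdifferentiableAt_fieldInChart hY).mfderiv.symm
  have hid : mfderiv I 𝓘(ℝ, E) (extChartAt I p) p = ContinuousLinearMap.id ℝ E := by
    rw [← TangentBundle.continuousLinearMapAt_trivializationAt (mem_chart_source H p)]
    ext w
    exact continuousLinearMapAt_trivializationAt_self p w
  rw [mlieBracket, mlieBracketWithin_apply, hlin, hid]
  exact congrArg (fun L : E →L[ℝ] E => L (mvfderiv I (fieldInChart I p Y) p v))
    ContinuousLinearMap.inverse_id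

/-- On the diagonal the Koszul formula reduces to half the Lie derivative of the metric. -/
theorem leviCivita_self (g : RiemannianMetric (fun x : X => TangentSpace I x)) {p : X}
    (v : TangentSpace I p) (Y : Π x : X, TangentSpace I x) :
    leviCivita g v Y v =
      (1 / 2) * mvfderiv I (fun q => metricInChart g p q v v) p (Y p)
        + g.inner p (mlieBracket I (FiberBundle.extend E v) Y p) v := by
  have h1 : (fun q => g.inner q (Y q) (FiberBundle.extend E v q)) =
      fun q => g.inner q (FiberBundle.extend E v q) (Y q) := funext fun q => g.symm q _ _
  have h2 : (fun q => metricInChart g p q v v) =ᶠ[𝓝 p]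
      fun q => g.inner q (FiberBundle.extend E v q) (FiberBundle.extend E v q) := by
    filter_upwards [chart_source_mem_nhds H p] with q hq using metricInChart_apply g hq v v
  rw [mvfderiv_congr_of_eventuallyEq h2]
  simp only [leviCivita, koszul, h1, mlieBracket_self,
    mlieBracket_swap_apply (V := Y) (W := FiberBundle.extend E v)]
  simp
  ring

theorem leviCivita_self_eq (g : RiemannianMetric (fun x : X => TangentSpace I x)) {p : X}
    (v : TangentSpace I p) {Y : Π x : X, TangentSpace I x}
    (hY : MDifferentiableAt I I.tangent (fun x => (⟨x, Y x⟩ : TangentBundle I X)) p) :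
    leviCivita g v Y v =
      (1 / 2) * mvfderiv I (fun q => metricInChart g p q v v) p (Y p)
        + g.inner p (mvfderiv I (fieldInChart I p Y) p v) v := by
  rw [leviCivita_self, mlieBracket_extend v hY]

end Coordinates

/-! ### Smoothness of the gradient -/

section Smoothness

variable {E : Type*} [NormedAddCommGroup E] [NormedSpace ℝ E]
  {H : Type*} [TopologicalSpace H] {I : ModelWithCorners ℝ E H}
  {X : Type*} [TopologicalSpace X] [ChartedSpace H X]

theorem ContinuousLinearMap.isInvertible_of_posDef [FiniteDimensional ℝ E]
    {B : E →L[ℝ] E →L[ℝ] ℝ} (hB : ∀ v, v ≠ 0 → 0 < B v v) : B.IsInvertible := by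
  have hinj : Function.Injective B.toLinearMap := by
    rw [injective_iff_map_eq_zero]
    intro v hv
    by_contra hne
    have h2 : B v v = 0 := congrArg (fun L : E →L[ℝ] ℝ => L v) hv
    exact (hB v hne).ne' h2
  have hrank : Module.finrank ℝ E = Module.finrank ℝ (E →L[ℝ] ℝ) := by
    rw [(LinearMap.toContinuousLinearMap (𝕜 := ℝ) (E := E) (F' := ℝ)).symm.finrank_eq]
    exact (Subspace.dual_finrank_eq (K := ℝ) (V := E)).symm
  refine ⟨(LinearEquiv.ofInjectiveOfFinrankEq B.toLinearMap hinj hrank).toContinuousLinearEquiv, ?_⟩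
  ext v w
  rfl

variable [IsManifold I ∞ X]

theorem contMDiffAt_metricInChart
    (g : ContMDiffRiemannianMetric I ∞ E (fun x : X => TangentSpace I x)) (p : X) :
    ContMDiffAt I 𝓘(ℝ, E →L[ℝ] E →L[ℝ] ℝ) ∞ (metricInChart g.toRiemannianMetric p) p := by
  have h := (contMDiffAt_hom_bundle _).1 (g.contMDiff p)
  refine h.2.congr_of_eventuallyEq ?_
  filter_upwards [chart_source_mem_nhds H p] with q hq
  ext v w
  refine Eq.trans ?_ (inCoordinates_apply_eq₂ hq hq (mem_univ _)).symm
  refine Eq.trans ?_ (congrArg (fun L : ℝ →ₗ[ℝ] ℝ => L _)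
    (Bundle.Trivial.linearMapAt_trivialization ℝ X ℝ q)).symm
  rw [← (trivializationAt E (TangentSpace I) p).symmL_apply (R := ℝ) hq v,
    ← (trivializationAt E (TangentSpace I) p).symmL_apply (R := ℝ) hq w]
  rfl

/-- The differential of a smooth function is smooth in the trivialization of the tangent bundle. -/
theorem contMDiffAt_mvfderiv_symmL {f : X → ℝ} {p : X} (hf : ContMDiffAt I 𝓘(ℝ, ℝ) ∞ f p) :
    ContMDiffAt I 𝓘(ℝ, E →L[ℝ] ℝ) ∞
      (fun q => (mvfderiv I f q ∘L (trivializationAt E (TangentSpace I) p).symmL ℝ q : E →L[ℝ] ℝ))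
      p := by
  refine (hf.mfderiv_const (m := ∞) (by simp)).congr_of_eventuallyEq ?_
  filter_upwards with q
  ext v
  refine (congrArg (fun L : ℝ →L[ℝ] ℝ => L (mvfderiv I f q
    ((trivializationAt E (TangentSpace I) p).symmL ℝ q v)))
    (TangentBundle.continuousLinearMapAt_model_space (𝕜 := ℝ) (f p) (f q))).symm

theorem pos_metricInChart (g : RiemannianMetric (fun x : X => TangentSpace I x)) {p q : X}
    (hq : q ∈ (trivializationAt E (TangentSpace I) p).baseSet) (v : E) (hv : v ≠ 0) :
    0 < metricInChart g p q v v := by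
  refine g.pos q _ fun h => hv ?_
  have h2 := (trivializationAt E (TangentSpace I) p).continuousLinearMapAt_symmL (R := ℝ) hq v
  rw [← h2]
  exact (congrArg _ h).trans (map_zero _)

theorem contMDiffAt_section_of_fieldInChart {p : X} {Y : Π x : X, TangentSpace I x}
    (hY : ContMDiffAt I 𝓘(ℝ, E) ∞ (fieldInChart I p Y) p) :
    ContMDiffAt I I.tangent ∞ (fun x => (⟨x, Y x⟩ : TangentBundle I X)) p := by
  refine (Bundle.contMDiffAt_section p).2 (hY.congr_of_eventuallyEq ?_)
  filter_upwards [chart_source_mem_nhds H p] with q hq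
  exact ((trivializationAt E (TangentSpace I) p).continuousLinearMapAt_apply_of_mem ℝ hq (Y q)).symm

/-- The gradient of a smooth function is smooth: in a chart it is the inverse of the metric applied
to the differential. -/
theorem ContMDiffAt.riemannianGradient [FiniteDimensional ℝ E]
    (g : ContMDiffRiemannianMetric I ∞ E (fun x : X => TangentSpace I x)) {f : X → ℝ} {p : X}
    (hf : ContMDiffAt I 𝓘(ℝ, ℝ) ∞ f p) :
    ContMDiffAt I I.tangent ∞
      (fun x => (⟨x, riemannianGradient g.toRiemannianMetric f x⟩ : TangentBundle I X)) p := by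
  have hbase := FiberBundle.mem_baseSet_trivializationAt' (F := E) (E := TangentSpace I) p
  have : CompleteSpace E := FiniteDimensional.complete ℝ E
  have hinv : ContMDiffAt I 𝓘(ℝ, (E →L[ℝ] ℝ) →L[ℝ] E) ∞
      (fun q => (metricInChart g.toRiemannianMetric p q).inverse) p :=
    ((ContinuousLinearMap.isInvertible_of_posDef
      (pos_metricInChart g.toRiemannianMetric hbase)).contDiffAt_map_inverse.contMDiffAt).comp p
      (contMDiffAt_metricInChart g p)
  refine contMDiffAt_section_of_fieldInChart
    ((hinv.clm_apply (contMDiffAt_mvfderiv_symmL hf)).congr_of_eventuallyEq ?_)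
  filter_upwards [chart_source_mem_nhds H p] with q hq
  obtain ⟨e, he⟩ := ContinuousLinearMap.isInvertible_of_posDef
    (pos_metricInChart g.toRiemannianMetric (I := I) (p := p) hq)
  rw [← he, ContinuousLinearMap.inverse_equiv]
  refine (e.symm_apply_eq.2 ?_).symm
  ext w
  change mvfderiv I f q _ = (e : E →L[ℝ] E →L[ℝ] ℝ) _ w
  rw [he, ← inner_riemannianGradient g.toRiemannianMetric f q]
  exact (congrArg (fun a => g.inner q a _) (symmL_fieldInChart hq _)).symm

end Smoothness

/-! ### The form `∇Y` and its chart expression -/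

section ProductRules

variable {E : Type*} [NormedAddCommGroup E] [NormedSpace ℝ E]
  {H : Type*} [TopologicalSpace H] {I : ModelWithCorners ℝ E H}
  {X : Type*} [TopologicalSpace X] [ChartedSpace H X]
  {F : Type*} [NormedAddCommGroup F] [NormedSpace ℝ F]
  {G : Type*} [NormedAddCommGroup G] [NormedSpace ℝ G]

theorem mvfderiv_normedSpace_comp_apply {f : X → F} {Φ : F → G} {p : X}
    (hΦ : DifferentiableAt ℝ Φ (f p))
    (hf : MDifferentiableAt I 𝓘(ℝ, F) f p) (u : TangentSpace I p) :
    mvfderiv I (fun q => Φ (f q)) p u = fderiv ℝ Φ (f p) (mvfderiv I f p u) := by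
  have h := mfderiv_comp (I := I) (I' := 𝓘(ℝ, F)) (I'' := 𝓘(ℝ, G)) p hΦ.mdifferentiableAt hf
  rw [mfderiv_eq_fderiv] at h
  exact congrArg (fun L : E →L[ℝ] G => L u) h

theorem mvfderiv_comp_mfderiv_apply {E' : Type*} [NormedAddCommGroup E'] [NormedSpace ℝ E']
    {H' : Type*} [TopologicalSpace H'] {I' : ModelWithCorners ℝ E' H'}
    {X' : Type*} [TopologicalSpace X'] [ChartedSpace H' X'] {f : X' → X} {Φ : X → F} {p : X'}
    (hΦ : MDifferentiableAt I 𝓘(ℝ, F) Φ (f p)) (hf : MDifferentiableAt I' I f p)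
    (u : TangentSpace I' p) :
    mvfderiv I' (fun q => Φ (f q)) p u = mvfderiv I Φ (f p) (mfderiv I' I f p u) :=
  mfderiv_comp_apply p hΦ hf u

theorem mvfderiv_real_comp_apply {f : X → ℝ} {Φ : ℝ → ℝ} {p : X}
    (hΦ : DifferentiableAt ℝ Φ (f p)) (hf : MDifferentiableAt I 𝓘(ℝ, ℝ) f p)
    (u : TangentSpace I p) :
    mvfderiv I (fun q => Φ (f q)) p u = deriv Φ (f p) * mvfderiv I f p u := by
  rw [mvfderiv_normedSpace_comp_apply (Φ := Φ) hΦ hf, fderiv_eq_smul_deriv, smul_eq_mul, mul_comm]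

theorem mvfderiv_prod_apply {f : X → F × G} {p : X}
    (hf : MDifferentiableAt I 𝓘(ℝ, F × G) f p) (u : TangentSpace I p) :
    mvfderiv I f p u =
      (mvfderiv I (fun q => (f q).1) p u, mvfderiv I (fun q => (f q).2) p u) := by
  have h1 := mvfderiv_normedSpace_comp_apply
    (Φ := fun y => ContinuousLinearMap.fst ℝ F G y)
    (ContinuousLinearMap.fst ℝ F G).differentiableAt hf u
  have h2 := mvfderiv_normedSpace_comp_apply
    (Φ := fun y => ContinuousLinearMap.snd ℝ F G y)
    (ContinuousLinearMap.snd ℝ F G).differentiableAt hf u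
  rw [ContinuousLinearMap.fderiv] at h1 h2
  exact Prod.ext h1.symm h2.symm

theorem mvfderiv_clm_apply {L : X → F →L[ℝ] G} {f : X → F} {p : X}
    (hL : MDifferentiableAt I 𝓘(ℝ, F →L[ℝ] G) L p) (hf : MDifferentiableAt I 𝓘(ℝ, F) f p)
    (u : TangentSpace I p) :
    mvfderiv I (fun q => L q (f q)) p u = L p (mvfderiv I f p u) + mvfderiv I L p u (f p) := by
  let A : E →L[ℝ] F := mvfderiv I f p
  let B : E →L[ℝ] F →L[ℝ] G := mvfderiv I L p
  let C : E →L[ℝ] G := (L p).comp A + B.flip (f p)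
  have h : HasMFDerivAt I 𝓘(ℝ, G) (fun q => L q (f q)) p C := by
    refine ⟨hL.continuousAt.clm_apply hf.continuousAt, ?_⟩
    have := hL.hasMFDerivAt.2.clm_apply hf.hasMFDerivAt.2
    simp only [mfld_simps] at this
    exact this
  exact congrArg (fun L : E →L[ℝ] G => L u) h.mfderiv

theorem MDifferentiableAt.clm_apply_vectorSpace {L : X → F →L[ℝ] G} {f : X → F} {p : X}
    (hL : MDifferentiableAt I 𝓘(ℝ, F →L[ℝ] G) L p) (hf : MDifferentiableAt I 𝓘(ℝ, F) f p) :
    MDifferentiableAt I 𝓘(ℝ, G) (fun q => L q (f q)) p :=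
  hL.clm_apply hf

end ProductRules

section Nabla

variable {E : Type*} [NormedAddCommGroup E] [NormedSpace ℝ E]
  {H : Type*} [TopologicalSpace H] {I : ModelWithCorners ℝ E H}
  {X : Type*} [TopologicalSpace X] [ChartedSpace H X] [IsManifold I 1 X]

/-- A bilinear form on `T_p X` whose diagonal values `v ↦ nablaForm g Y p v v` are those of
`g(∇_v Y, v)`: half the derivative of the metric along `Y` plus `g(DY v, w)`, both taken in the
preferred chart at `p`. -/
def nablaForm (g : RiemannianMetric (fun x : X => TangentSpace I x))
    (Y : Π x : X, TangentSpace I x) (p : X) :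
    TangentSpace I p →L[ℝ] TangentSpace I p →L[ℝ] ℝ :=
  let D : E →L[ℝ] E →L[ℝ] ℝ := mvfderiv I (metricInChart g p) p (Y p)
  let D' : E →L[ℝ] E := mvfderiv I (fieldInChart I p Y) p
  let G : E →L[ℝ] E →L[ℝ] ℝ := g.inner p
  let B : E →L[ℝ] E →L[ℝ] ℝ := (1 / 2 : ℝ) • D + G.comp D'
  B

theorem nablaForm_apply (g : RiemannianMetric (fun x : X => TangentSpace I x))
    (Y : Π x : X, TangentSpace I x) (p : X) (v w : TangentSpace I p) :
    nablaForm g Y p v w = (1 / 2) * mvfderiv I (metricInChart g p) p (Y p) v w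
      + g.inner p (mvfderiv I (fieldInChart I p Y) p v) w :=
  rfl

theorem mvfderiv_metricInChart_apply {g : RiemannianMetric (fun x : X => TangentSpace I x)} {p : X}
    (hg : MDifferentiableAt I 𝓘(ℝ, E →L[ℝ] E →L[ℝ] ℝ) (metricInChart g p) p) (v w : E)
    (u : TangentSpace I p) :
    mvfderiv I (fun q => metricInChart g p q v w) p u
      = mvfderiv I (metricInChart g p) p u v w := by
  rw [mvfderiv_clm_apply (L := fun q => metricInChart g p q v) (f := fun _ => w)
      (hg.clm_apply_vectorSpace mdifferentiableAt_const) mdifferentiableAt_const,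
    mvfderiv_clm_apply hg mdifferentiableAt_const]
  simp [mvfderiv_const]

/-- Metric compatibility of the connection, on the diagonal: `2 g(∇_Y Y, Y) = Y(g(Y, Y))`. -/
theorem two_mul_nablaForm_self {g : RiemannianMetric (fun x : X => TangentSpace I x)} {p : X}
    (hg : MDifferentiableAt I 𝓘(ℝ, E →L[ℝ] E →L[ℝ] ℝ) (metricInChart g p) p)
    {Y : Π x : X, TangentSpace I x}
    (hY : MDifferentiableAt I I.tangent (fun x => (⟨x, Y x⟩ : TangentBundle I X)) p) :
    2 * nablaForm g Y p (Y p) (Y p) = mvfderiv I (fun q => g.inner q (Y q) (Y q)) p (Y p) := by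
  have hY' := mdifferentiableAt_fieldInChart hY
  have hev : (fun q => g.inner q (Y q) (Y q)) =ᶠ[𝓝 p]
      fun q => metricInChart g p q (fieldInChart I p Y q) (fieldInChart I p Y q) := by
    filter_upwards [chart_source_mem_nhds H p] with q hq
    exact (metricInChart_fieldInChart g hq Y Y).symm
  rw [mvfderiv_congr_of_eventuallyEq hev,
    mvfderiv_clm_apply (hg.clm_apply_vectorSpace hY') hY', mvfderiv_clm_apply hg hY']
  rw [nablaForm_apply, fieldInChart_self, metricInChart_self]
  have hs := g.symm p (mvfderiv I (fieldInChart I p Y) p (Y p)) (Y p)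
  change _ = g.inner p (Y p) (mvfderiv I (fieldInChart I p Y) p (Y p))
    + (g.inner p (mvfderiv I (fieldInChart I p Y) p (Y p)) (Y p)
      + mvfderiv I (metricInChart g p) p (Y p) (Y p) (Y p))
  rw [hs]
  ring

set_option synthInstance.maxHeartbeats 200000 in
/-- The derivative of the coefficient `b` does not contribute on vectors orthogonal to `Y`. -/
theorem leviCivita_smul_of_orthogonal {g : RiemannianMetric (fun x : X => TangentSpace I x)} {p : X}
    (hg : MDifferentiableAt I 𝓘(ℝ, E →L[ℝ] E →L[ℝ] ℝ) (metricInChart g p) p)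
    {b : X → ℝ} (hb : MDifferentiableAt I 𝓘(ℝ, ℝ) b p) {Y : Π x : X, TangentSpace I x}
    (hY : MDifferentiableAt I I.tangent (fun x => (⟨x, Y x⟩ : TangentBundle I X)) p)
    {v : TangentSpace I p} (hv : g.inner p (Y p) v = 0) :
    leviCivita g v (fun q => b q • Y q) v = b p * nablaForm g Y p v v := by
  have hbY : MDifferentiableAt I I.tangent (fun x => (⟨x, b x • Y x⟩ : TangentBundle I X)) p :=
    hb.smul_section hY
  have hfield : fieldInChart I p (fun q => b q • Y q) = fun q => b q • fieldInChart I p Y q :=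
    funext fun q => map_smul _ _ _
  rw [leviCivita_self_eq g v hbY, hfield, nablaForm_apply,
    mvfderiv_metricInChart_apply hg v v (b p • Y p),
    mvfderiv_fun_smul hb (mdifferentiableAt_fieldInChart hY)]
  have key : ∀ (D : E →L[ℝ] E →L[ℝ] E →L[ℝ] ℝ) (G : E →L[ℝ] E →L[ℝ] ℝ) (A : E →L[ℝ] E)
      (B : E →L[ℝ] ℝ) (y v : E), G y v = 0 →
      1 / 2 * D (b p • y) v v + G ((b p • A + B.smulRight y) v) v =
        b p * (1 / 2 * D y v v + G (A v) v) := by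
    intro D G A B y v h
    simp only [map_smul, smul_apply, add_apply,
      ContinuousLinearMap.smulRight_apply, map_add, smul_eq_mul, h]
    ring
  rw [fieldInChart_self]
  exact key (mvfderiv I (metricInChart g p) p) (g.inner p) (mvfderiv I (fieldInChart I p Y) p)
    (mvfderiv I b p) (Y p) v hv

end Nabla

/-! ### The gradient of a Riemannian submersion and the mean curvature of its fibres -/

section Submersion

variable {E : Type*} [NormedAddCommGroup E] [NormedSpace ℝ E] [FiniteDimensional ℝ E]
  {H : Type*} [TopologicalSpace H] {I : ModelWithCorners ℝ E H}
  {M : Type*} [TopologicalSpace M] [ChartedSpace H M]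

/-- The squared norm of the gradient of a Riemannian submersion onto `(J, α ds²)` is `1 / α`: the
gradient is orthogonal to the kernel of the differential, where the submersion is isometric. -/
theorem IsRiemannianSubmersionOnto.inner_gradient_self
    {g : RiemannianMetric (fun x : M => TangentSpace I x)} {proj : M → ℝ} {J : Set ℝ} {α : ℝ → ℝ}
    (hproj : IsRiemannianSubmersionOnto g proj J α) (x : M) :
    g.inner x (riemannianGradient g proj x) (riemannianGradient g proj x) = (α (proj x))⁻¹ := by
  set P := riemannianGradient g proj x
  have hP : ∀ w, g.inner x P w = mvfderiv I proj x w := inner_riemannianGradient g proj x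
  obtain ⟨w, hw⟩ := hproj.surjective x 1
  have hP0 : P ≠ 0 := by
    intro h
    have := hP w
    rw [hw, h, map_zero] at this
    exact zero_ne_one this
  have hpos := g.pos x P hP0
  have hiso := hproj.isometric x P fun w hw => (hP w).trans hw
  rw [← hP] at hiso
  have h1 : g.inner x P P * (α (proj x) * g.inner x P P - 1) = 0 := by linarith
  have h2 := (mul_eq_zero.1 h1).resolve_left hpos.ne'
  exact eq_inv_of_mul_eq_one_right (by linarith)

variable [IsManifold I ∞ M]

/-- `g(∇_P P, P)` for `P = ∇proj`, obtained by differentiating `g(P, P) = 1 / α` along `P`. -/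
theorem IsRiemannianSubmersionOnto.nablaForm_gradient_self
    {g : ContMDiffRiemannianMetric I ∞ E (fun x : M => TangentSpace I x)}
    {proj : M → ℝ} {J : Set ℝ} {α : ℝ → ℝ}
    (hproj : IsRiemannianSubmersionOnto g.toRiemannianMetric proj J α) {x : M}
    (hα : DifferentiableAt ℝ α (proj x)) (hα0 : α (proj x) ≠ 0) :
    nablaForm g.toRiemannianMetric (riemannianGradient g.toRiemannianMetric proj) x
      (riemannianGradient g.toRiemannianMetric proj x)
      (riemannianGradient g.toRiemannianMetric proj x)
      = -(deriv α (proj x)) / (2 * α (proj x) ^ 3) := by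
  have hg := (contMDiffAt_metricInChart g x).mdifferentiableAt (by simp)
  have hP := (ContMDiffAt.riemannianGradient g (hproj.smooth x)).mdifferentiableAt (by simp)
  have h := two_mul_nablaForm_self hg hP
  rw [funext hproj.inner_gradient_self,
    mvfderiv_real_comp_apply (Φ := fun s => (α s)⁻¹) (hα.inv hα0)
      ((hproj.smooth x).mdifferentiableAt (by simp)),
    ← inner_riemannianGradient, hproj.inner_gradient_self, deriv_fun_inv'' hα hα0] at h
  field_simp at h ⊢
  linarith

/-- The mean curvature of the fibres in terms of the trace of `∇P`, where `P = ∇proj`. With respect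
to `-√α P` it is `√α` times the trace of `∇P` over `P^⊥`. -/
theorem IsSubmersive.fibre_meanCurvature_eq
    {g : ContMDiffRiemannianMetric I ∞ E (fun x : M => TangentSpace I x)}
    {φ : M → ℝ} {proj : M → ℝ} {J : Set ℝ} {α φhat h : ℝ → ℝ}
    (hsub : IsSubmersive g.toRiemannianMetric φ proj J α φhat h) {x : M}
    (hα : DifferentiableAt ℝ α (proj x)) :
    h (proj x) = √(α (proj x)) * (metricTrace g.toRiemannianMetric x
        (nablaForm g.toRiemannianMetric (riemannianGradient g.toRiemannianMetric proj) x)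
      + deriv α (proj x) / (2 * α (proj x) ^ 2)) := by
  set P := riemannianGradient g.toRiemannianMetric proj
  have hproj := hsub.submersion
  have hxJ : proj x ∈ J := hproj.range_eq ▸ mem_range_self x
  have hα0 := hsub.alpha_pos _ hxJ
  have hs0 := Real.sqrt_pos.2 hα0
  have hs2 := Real.sq_sqrt hα0.le
  have hg := (contMDiffAt_metricInChart g x).mdifferentiableAt (by simp)
  have hP := (ContMDiffAt.riemannianGradient g (hproj.smooth x)).mdifferentiableAt (by simp)
  have hν : fibreNormal g.toRiemannianMetric proj = fun q => (-√(α (proj q))) • P q := by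
    funext q
    rw [fibreNormal, hproj.inner_gradient_self, Real.sqrt_inv, inv_inv, neg_smul]
  have hb : MDifferentiableAt I 𝓘(ℝ, ℝ) (fun q => -√(α (proj q))) x :=
    (DifferentiableAt.mdifferentiableAt (hα.sqrt hα0.ne').neg).comp x
      ((hproj.smooth x).mdifferentiableAt (by simp))
  have hνν : g.inner x (-√(α (proj x)) • P x) (-√(α (proj x)) • P x) = 1 := by
    have := hproj.inner_gradient_self x
    change g.inner x (P x) (P x) = _ at this
    simp [this, ← mul_assoc]
    field_simp
    linarith
  rw [← hsub.fibres _ hxJ x rfl, hν,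
    meanCurvature_eq_metricTrace g.toRiemannianMetric g.toRiemannianMetric _ x x
      (ContinuousLinearMap.id ℝ _) id (fun _ _ => rfl) (fun _ => rfl)
      (√(α (proj x)) • nablaForm g.toRiemannianMetric P x)]
  · have h1 := hproj.nablaForm_gradient_self hα hα0.ne'
    change nablaForm g.toRiemannianMetric P x (P x) (P x) = _ at h1
    change _ - _ / g.inner x (-√(α (proj x)) • P x) (-√(α (proj x)) • P x) = _
    rw [hνν, metricTrace_smul]
    simp [h1]
    field_simp
    rw [hs2]
    ring
  · intro v hv
    have hv' : g.toRiemannianMetric.inner x (P x) v = 0 := by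
      simpa [hs0.ne'] using hv
    rw [leviCivita_smul_of_orthogonal hg hb hP hv']
    change -(-√(α (proj x)) * _) = √(α (proj x)) * _
    rw [neg_mul, neg_neg]
    rfl

end Submersion

/-! ### Vector fields along graphs in a warped product -/

section WarpedGraph

variable {E : Type*} [NormedAddCommGroup E] [NormedSpace ℝ E]
  {H : Type*} [TopologicalSpace H] {I : ModelWithCorners ℝ E H}
  {M : Type*} [TopologicalSpace M] [ChartedSpace H M]

theorem mfderiv_graph_apply {u : M → ℝ} {x : M} (hu : MDifferentiableAt I 𝓘(ℝ, ℝ) u x)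
    (w : TangentSpace I x) :
    mfderiv I (I.prod 𝓘(ℝ, ℝ)) (fun z => (z, u z)) x w = ((w, mvfderiv I u x w) : E × ℝ) := by
  have h := mfderiv_prodMk (mdifferentiableAt_id (I := I) (x := x)) hu
  rw [mfderiv_id] at h
  exact congrArg (fun L : E →L[ℝ] E × ℝ => L w) h

theorem mdifferentiableAt_graph {u : M → ℝ} {x : M} (hu : MDifferentiableAt I 𝓘(ℝ, ℝ) u x) :
    MDifferentiableAt I (I.prod 𝓘(ℝ, ℝ)) (fun z => (z, u z)) x :=
  mdifferentiableAt_id.prodMk hu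

variable [IsManifold I 1 M]

/-- The preferred trivialization of the tangent bundle of `M × ℝ` is the product of that of `M` and
the identity. -/
theorem continuousLinearMapAt_trivializationAt_prod_real (x : M) (r : ℝ) {q : M × ℝ}
    (hq : q.1 ∈ (chartAt H x).source) (w : E) (a : ℝ) :
    (trivializationAt (E × ℝ) (TangentSpace (I.prod 𝓘(ℝ, ℝ))) (x, r)).continuousLinearMapAt ℝ q
      ((w, a) : E × ℝ) =
      ((trivializationAt E (TangentSpace I) x).continuousLinearMapAt ℝ q.1 w, a) := by
  have hq' : q ∈ (chartAt (ModelProd H ℝ) (x, r)).source := by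
    rw [prodChartedSpace_chartAt]
    exact ⟨hq, mem_univ _⟩
  have h : ∀ y : M × ℝ, extChartAt (I.prod 𝓘(ℝ, ℝ)) (x, r) y = (extChartAt I x y.1, y.2) := by
    intro y
    rw [extChartAt_prod]
    rfl
  have hd : MDifferentiableAt (I.prod 𝓘(ℝ, ℝ)) 𝓘(ℝ, E × ℝ)
      (extChartAt (I.prod 𝓘(ℝ, ℝ)) (x, r)) q := mdifferentiableAt_extChartAt hq'
  have h1 : mvfderiv (I.prod 𝓘(ℝ, ℝ)) (fun y : M × ℝ => extChartAt I x y.1) q ((w, a) : E × ℝ)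
      = mvfderiv I (extChartAt I x) q.1 w := by
    refine (mvfderiv_comp_mfderiv_apply (f := Prod.fst) (p := q)
      (mdifferentiableAt_extChartAt (I := I) hq)
      mdifferentiableAt_fst _).trans ?_
    rw [mfderiv_fst]
    rfl
  have h2 : mvfderiv (I.prod 𝓘(ℝ, ℝ)) (fun y : M × ℝ => y.2) q ((w, a) : E × ℝ) = a := by
    rw [mvfderiv, mfderiv_snd]
    rfl
  rw [TangentBundle.continuousLinearMapAt_trivializationAt hq',
    TangentBundle.continuousLinearMapAt_trivializationAt hq]
  refine (mvfderiv_prod_apply hd ((w, a) : E × ℝ)).trans ?_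
  simp only [h]
  exact Prod.ext h1 h2

theorem metricInChart_warpedMetric (g : RiemannianMetric (fun x : M => TangentSpace I x))
    (φ : M → ℝ) (hφ : ∀ x, 0 < φ x) (x : M) (r : ℝ) {q : M × ℝ}
    (hq : q.1 ∈ (chartAt H x).source) (w : E) (a : ℝ) :
    metricInChart (warpedMetric g φ hφ) (x, r) q (w, a) (w, a) =
      metricInChart g x q.1 w w + φ q.1 * (a * a) := by
  have hq' : q ∈ (trivializationAt (E × ℝ) (TangentSpace (I.prod 𝓘(ℝ, ℝ))) (x, r)).baseSet := by
    change q ∈ (chartAt (ModelProd H ℝ) (x, r)).source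
    rw [prodChartedSpace_chartAt]
    exact ⟨hq, mem_univ _⟩
  set e := trivializationAt E (TangentSpace I) x
  have h1 : e.continuousLinearMapAt ℝ q.1 (e.symmL ℝ q.1 w) = w :=
    e.continuousLinearMapAt_symmL hq w
  have h2 := continuousLinearMapAt_trivializationAt_prod_real (I := I) x r hq (e.symmL ℝ q.1 w) a
  rw [h1] at h2
  have h3 : (trivializationAt (E × ℝ) (TangentSpace (I.prod 𝓘(ℝ, ℝ))) (x, r)).symmL ℝ q (w, a)
      = ((e.symmL ℝ q.1 w : E), a) := by
    rw [← h2]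
    exact Trivialization.symmL_continuousLinearMapAt _ hq' _
  change (warpedMetric g φ hφ).inner q (Trivialization.symmL ℝ _ q (w, a))
    (Trivialization.symmL ℝ _ q (w, a)) = _
  rw [h3]
  rfl

/-- The component along `M` of the restriction to the graph of `u` of a vector field on `M × ℝ`. -/
def graphFst (u : M → ℝ) (ν : Π p : M × ℝ, TangentSpace (I.prod 𝓘(ℝ, ℝ)) p) (z : M) :
    TangentSpace I z :=
  (ν (z, u z) : E × ℝ).1

/-- The component along `ℝ` of the restriction to the graph of `u` of a vector field on
`M × ℝ`. -/
def graphSnd (u : M → ℝ) (ν : Π p : M × ℝ, TangentSpace (I.prod 𝓘(ℝ, ℝ)) p) (z : M) : ℝ :=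
  (ν (z, u z) : E × ℝ).2

/-- Along a graph, the coordinates of a vector field on `M × ℝ` are those of its two components. -/
theorem fieldInChart_graph_eventuallyEq (u : M → ℝ)
    (ν : Π p : M × ℝ, TangentSpace (I.prod 𝓘(ℝ, ℝ)) p) (x : M) :
    (fun z => fieldInChart (I.prod 𝓘(ℝ, ℝ)) (x, u x) ν (z, u z)) =ᶠ[𝓝 x]
      fun z => ((fieldInChart I x (graphFst u ν) z, graphSnd u ν z) : E × ℝ) := by
  filter_upwards [chart_source_mem_nhds H x] with z hz
  exact continuousLinearMapAt_trivializationAt_prod_real (I := I) x (u x) (q := (z, u z)) hz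
    (ν (z, u z) : E × ℝ).1 (ν (z, u z) : E × ℝ).2

theorem mdifferentiableAt_fieldInChart_graph {u : M → ℝ}
    {ν : Π p : M × ℝ, TangentSpace (I.prod 𝓘(ℝ, ℝ)) p} {x : M}
    (hu : MDifferentiableAt I 𝓘(ℝ, ℝ) u x)
    (hν : MDifferentiableAt (I.prod 𝓘(ℝ, ℝ)) (I.prod 𝓘(ℝ, ℝ)).tangent
      (fun y => (⟨y, ν y⟩ : TangentBundle (I.prod 𝓘(ℝ, ℝ)) (M × ℝ))) (x, u x)) :
    MDifferentiableAt I 𝓘(ℝ, E × ℝ)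
      (fun z => ((fieldInChart I x (graphFst u ν) z, graphSnd u ν z) : E × ℝ)) x :=
  MDifferentiableAt.congr_of_eventuallyEq
    (MDifferentiableAt.comp (g := fieldInChart (I.prod 𝓘(ℝ, ℝ)) (x, u x) ν) x
      (mdifferentiableAt_fieldInChart hν) (mdifferentiableAt_graph hu))
    (fieldInChart_graph_eventuallyEq u ν x).symm

theorem mdifferentiableAt_graphSnd {u : M → ℝ}
    {ν : Π p : M × ℝ, TangentSpace (I.prod 𝓘(ℝ, ℝ)) p} {x : M}
    (hu : MDifferentiableAt I 𝓘(ℝ, ℝ) u x)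
    (hν : MDifferentiableAt (I.prod 𝓘(ℝ, ℝ)) (I.prod 𝓘(ℝ, ℝ)).tangent
      (fun y => (⟨y, ν y⟩ : TangentBundle (I.prod 𝓘(ℝ, ℝ)) (M × ℝ))) (x, u x)) :
    MDifferentiableAt I 𝓘(ℝ, ℝ) (graphSnd u ν) x :=
  MDifferentiableAt.comp x
    (f := fun z => ((fieldInChart I x (graphFst u ν) z, graphSnd u ν z) : E × ℝ))
    (ContinuousLinearMap.snd ℝ E ℝ).differentiableAt.mdifferentiableAt
    (mdifferentiableAt_fieldInChart_graph hu hν)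

/-- The derivative of a vector field on `M × ℝ` in a direction tangent to a graph depends only on
its restriction to the graph, and is computed componentwise. -/
theorem mvfderiv_fieldInChart_graph {u : M → ℝ}
    {ν : Π p : M × ℝ, TangentSpace (I.prod 𝓘(ℝ, ℝ)) p} {x : M}
    (hu : MDifferentiableAt I 𝓘(ℝ, ℝ) u x)
    (hν : MDifferentiableAt (I.prod 𝓘(ℝ, ℝ)) (I.prod 𝓘(ℝ, ℝ)).tangent
      (fun y => (⟨y, ν y⟩ : TangentBundle (I.prod 𝓘(ℝ, ℝ)) (M × ℝ))) (x, u x))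
    (w : TangentSpace I x) :
    mvfderiv (I.prod 𝓘(ℝ, ℝ)) (fieldInChart (I.prod 𝓘(ℝ, ℝ)) (x, u x) ν) (x, u x)
      ((w, mvfderiv I u x w) : E × ℝ) =
      (mvfderiv I (fieldInChart I x (graphFst u ν)) x w, mvfderiv I (graphSnd u ν) x w) := by
  have hd := mdifferentiableAt_fieldInChart_graph hu hν
  have h1 : mvfderiv I (fun z => fieldInChart (I.prod 𝓘(ℝ, ℝ)) (x, u x) ν (z, u z)) x w =
      mvfderiv (I.prod 𝓘(ℝ, ℝ)) (fieldInChart (I.prod 𝓘(ℝ, ℝ)) (x, u x) ν) (x, u x)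
        (mfderiv I (I.prod 𝓘(ℝ, ℝ)) (fun z => (z, u z)) x w) :=
    mvfderiv_comp_mfderiv_apply (f := fun z => (z, u z)) (mdifferentiableAt_fieldInChart hν)
      (mdifferentiableAt_graph hu) w
  rw [mfderiv_graph_apply hu] at h1
  refine h1.symm.trans ?_
  rw [mvfderiv_congr_of_eventuallyEq (fieldInChart_graph_eventuallyEq u ν x)]
  exact mvfderiv_prod_apply hd w

/-- `g(∇_v ν, v)` in the warped product, for `v = (w, du(w))` tangent to the graph of `u`, in terms
of the two components of `ν` along the graph. -/
theorem leviCivita_warpedMetric_graph {u : M → ℝ}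
    {ν : Π p : M × ℝ, TangentSpace (I.prod 𝓘(ℝ, ℝ)) p} {x : M}
    (hu : MDifferentiableAt I 𝓘(ℝ, ℝ) u x)
    (hν : MDifferentiableAt (I.prod 𝓘(ℝ, ℝ)) (I.prod 𝓘(ℝ, ℝ)).tangent
      (fun y => (⟨y, ν y⟩ : TangentBundle (I.prod 𝓘(ℝ, ℝ)) (M × ℝ))) (x, u x))
    {g : RiemannianMetric (fun x : M => TangentSpace I x)}
    {φ : M → ℝ} (hφ : ∀ x, 0 < φ x)
    (hg : MDifferentiableAt I 𝓘(ℝ, E →L[ℝ] E →L[ℝ] ℝ) (metricInChart g x) x)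
    (hφd : MDifferentiableAt I 𝓘(ℝ, ℝ) φ x) (w : TangentSpace I x) :
    leviCivita (warpedMetric g φ hφ) (p := (x, u x)) ((w, mvfderiv I u x w) : E × ℝ) ν
      ((w, mvfderiv I u x w) : E × ℝ) =
      1 / 2 * (mvfderiv I (metricInChart g x) x (graphFst u ν x) w w
          + mvfderiv I φ x (graphFst u ν x) * (mvfderiv I u x w * mvfderiv I u x w))
        + (g.inner x (mvfderiv I (fieldInChart I x (graphFst u ν)) x w) w
          + φ x * (mvfderiv I (graphSnd u ν) x w * mvfderiv I u x w)) := by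
  set a := mvfderiv I u x w
  have hGw : MDifferentiableAt I 𝓘(ℝ, ℝ) (fun z => metricInChart g x z w w) x :=
    (hg.clm_apply_vectorSpace mdifferentiableAt_const).clm_apply_vectorSpace
      mdifferentiableAt_const
  have hk : MDifferentiableAt I 𝓘(ℝ, ℝ) (fun z => metricInChart g x z w w + φ z * (a * a)) x :=
    hGw.add (hφd.mul mdifferentiableAt_const)
  have h1 : (fun q : M × ℝ => metricInChart (warpedMetric g φ hφ) (x, u x) q (w, a) (w, a))
      =ᶠ[𝓝 (x, u x)]
      fun q => metricInChart g x q.1 w w + φ q.1 * (a * a) := by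
    filter_upwards [continuous_fst.continuousAt.preimage_mem_nhds
      (chart_source_mem_nhds H (x, u x).1)] with q hq
    exact metricInChart_warpedMetric g φ hφ x (u x) hq w a
  have h2 : mvfderiv (I.prod 𝓘(ℝ, ℝ))
      (fun q : M × ℝ => metricInChart (warpedMetric g φ hφ) (x, u x) q (w, a) (w, a)) (x, u x)
      (ν (x, u x)) = mvfderiv I (metricInChart g x) x (graphFst u ν x) w w
          + mvfderiv I φ x (graphFst u ν x) * (a * a) := by
    rw [mvfderiv_congr_of_eventuallyEq h1,
      mvfderiv_comp_mfderiv_apply (f := Prod.fst) (p := (x, u x)) hk mdifferentiableAt_fst,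
      mfderiv_fst]
    change mvfderiv I _ x (graphFst u ν x) = _
    have hφa : MDifferentiableAt I 𝓘(ℝ, ℝ) (fun z => φ z * (a * a)) x :=
      hφd.mul mdifferentiableAt_const
    rw [mvfderiv_fun_add hGw hφa,
      mvfderiv_fun_mul hφd mdifferentiableAt_const, mvfderiv_const,
      ← mvfderiv_metricInChart_apply hg w w (graphFst u ν x)]
    simp
    ring
  have h3 := leviCivita_self_eq (warpedMetric g φ hφ) (p := (x, u x)) ((w, a) : E × ℝ) hν
  rw [h3, h2, mvfderiv_fieldInChart_graph hu hν]
  rfl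

end WarpedGraph

/-! ### Shape operator of the graph of a function of the submersion -/

section UnitNormal

variable {E : Type*} [NormedAddCommGroup E] [NormedSpace ℝ E]
  {H : Type*} [TopologicalSpace H] {I : ModelWithCorners ℝ E H}
  {M : Type*} [TopologicalSpace M] [ChartedSpace H M]

theorem RiemannianMetric.eq_of_inner_eq {g : RiemannianMetric (fun x : M => TangentSpace I x)}
    {x : M} {v w : TangentSpace I x} (h : ∀ a, g.inner x v a = g.inner x w a) : v = w := by
  by_contra hne
  have h1 := g.pos x (v - w) (sub_ne_zero.2 hne)
  have h2 : g.inner x (v - w) = g.inner x v - g.inner x w := map_sub _ _ _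
  rw [h2] at h1
  change 0 < g.inner x v (v - w) - g.inner x w (v - w) at h1
  rw [h, sub_self] at h1
  exact lt_irrefl _ h1

theorem inner_warpedMetric_graph (g : RiemannianMetric (fun x : M => TangentSpace I x))
    (φ : M → ℝ) (hφ : ∀ x, 0 < φ x) (u : M → ℝ)
    (ν : Π p : M × ℝ, TangentSpace (I.prod 𝓘(ℝ, ℝ)) p) (z : M) (w : TangentSpace I z) (a : ℝ) :
    (warpedMetric g φ hφ).inner (z, u z) (ν (z, u z)) ((w, a) : E × ℝ) =
      g.inner z (graphFst u ν z) w + φ z * (graphSnd u ν z * a) :=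
  rfl

theorem inner_warpedMetric_graph_self (g : RiemannianMetric (fun x : M => TangentSpace I x))
    (φ : M → ℝ) (hφ : ∀ x, 0 < φ x) (u : M → ℝ)
    (ν : Π p : M × ℝ, TangentSpace (I.prod 𝓘(ℝ, ℝ)) p) (z : M) :
    (warpedMetric g φ hφ).inner (z, u z) (ν (z, u z)) (ν (z, u z)) =
      g.inner z (graphFst u ν z) (graphFst u ν z) + φ z * (graphSnd u ν z * graphSnd u ν z) :=
  rfl

/-- Orthogonality to the graph of `u` at a point where `du` is the multiple `c` of `d proj`: the
component along `M` is determined by the component along `ℝ`. -/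
theorem graphFst_eq_smul_gradient [FiniteDimensional ℝ E]
    {g : RiemannianMetric (fun x : M => TangentSpace I x)}
    {φ : M → ℝ} (hφ : ∀ x, 0 < φ x) {u proj : M → ℝ}
    {ν : Π p : M × ℝ, TangentSpace (I.prod 𝓘(ℝ, ℝ)) p} {z : M} {c : ℝ}
    (hu : MDifferentiableAt I 𝓘(ℝ, ℝ) u z)
    (hc : ∀ w, mvfderiv I u z w = c * mvfderiv I proj z w)
    (hn : ∀ w : TangentSpace I z, (warpedMetric g φ hφ).inner (z, u z) (ν (z, u z))
      (mfderiv I (I.prod 𝓘(ℝ, ℝ)) (fun z => (z, u z)) z w) = 0) :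
    graphFst u ν z = (-(φ z * graphSnd u ν z * c)) • riemannianGradient g proj z := by
  refine RiemannianMetric.eq_of_inner_eq (g := g) fun w => ?_
  have h := hn w
  rw [mfderiv_graph_apply hu, inner_warpedMetric_graph, hc] at h
  rw [map_smul]
  change _ = -(φ z * graphSnd u ν z * c) * g.inner z (riemannianGradient g proj z) w
  rw [inner_riemannianGradient]
  linarith

theorem killingField_eq (p : M × ℝ) : killingField I p = ((0, 1) : E × ℝ) := by
  have h2 : MDifferentiableAt 𝓘(ℝ, ℝ) 𝓘(ℝ, ℝ) (fun t : ℝ => p.2 + t) 0 :=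
    (differentiableAt_id.const_add p.2).mdifferentiableAt
  have h := mfderiv_prodMk (mdifferentiableAt_const (I := 𝓘(ℝ, ℝ)) (I' := I) (c := p.1) (x := 0)) h2
  rw [mfderiv_const, mfderiv_eq_fderiv] at h
  have h3 : fderiv ℝ (fun t : ℝ => p.2 + t) 0 = ContinuousLinearMap.id ℝ ℝ := by
    rw [fderiv_const_add]
    exact fderiv_fun_id
  refine (congrArg (fun L : ℝ →L[ℝ] E × ℝ => L 1) h).trans ?_
  refine Prod.ext rfl ?_
  exact congrArg (fun L : ℝ →L[ℝ] ℝ => L 1) h3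

end UnitNormal

section MeanCurvature

variable {E : Type*} [NormedAddCommGroup E] [NormedSpace ℝ E] [FiniteDimensional ℝ E]
  {H : Type*} [TopologicalSpace H] {I : ModelWithCorners ℝ E H}
  {M : Type*} [TopologicalSpace M] [ChartedSpace H M] [IsManifold I ∞ M]

set_option synthInstance.maxHeartbeats 200000 in
/-- `g(∇_v ν, v)` for a normal field `ν` along the graph of `f ∘ proj` and a tangent vector `v =
(w, f' d proj(w))` of the graph. The derivative of the component of `ν` along `ℝ` cancels, as `ν`
is orthogonal to `v`. -/
theorem leviCivita_warpedMetric_graph_comp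
    {g : ContMDiffRiemannianMetric I ∞ E (fun x : M => TangentSpace I x)}
    {φ : M → ℝ} (hφ : ∀ x, 0 < φ x)
    {proj : M → ℝ} {f φhat : ℝ → ℝ} {x : M} {c : ℝ}
    (hproj : ContMDiffAt I 𝓘(ℝ, ℝ) ∞ proj x)
    (hφhat : DifferentiableAt ℝ φhat (proj x)) (hφeq : ∀ z, φ z = φhat (proj z))
    (hf : DifferentiableAt ℝ f (proj x))
    (hf' : DifferentiableAt ℝ (deriv f) (proj x))
    (hPP : g.inner x (riemannianGradient g.toRiemannianMetric proj x)
      (riemannianGradient g.toRiemannianMetric proj x) = c)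
    {ν : Π p : M × ℝ, TangentSpace (I.prod 𝓘(ℝ, ℝ)) p}
    (hν : MDifferentiableAt (I.prod 𝓘(ℝ, ℝ)) (I.prod 𝓘(ℝ, ℝ)).tangent
      (fun y => (⟨y, ν y⟩ : TangentBundle (I.prod 𝓘(ℝ, ℝ)) (M × ℝ))) (x, f (proj x)))
    (hX : ∀ᶠ z in 𝓝 x, graphFst (fun z => f (proj z)) ν z =
      (-(φ z * graphSnd (fun z => f (proj z)) ν z * deriv f (proj z))) •
        riemannianGradient g.toRiemannianMetric proj z)
    (w : TangentSpace I x) :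
    leviCivita (warpedMetric g.toRiemannianMetric φ hφ) (p := (x, f (proj x)))
      ((w, deriv f (proj x) * mvfderiv I proj x w) : E × ℝ) ν
      ((w, deriv f (proj x) * mvfderiv I proj x w) : E × ℝ) =
      -(φ x * graphSnd (fun z => f (proj z)) ν x) *
        (deriv f (proj x) *
            nablaForm g.toRiemannianMetric (riemannianGradient g.toRiemannianMetric proj) x w w
          + (deriv (deriv f) (proj x) + deriv φhat (proj x) * deriv f (proj x) ^ 3 * c / 2
              + deriv φhat (proj x) * deriv f (proj x) / φ x)
            * (mvfderiv I proj x w * mvfderiv I proj x w)) := by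
  set P := riemannianGradient g.toRiemannianMetric proj with hPdef
  set u : M → ℝ := fun z => f (proj z) with hudef
  set X₂ := graphSnd u ν with hX₂
  have hpd : MDifferentiableAt I 𝓘(ℝ, ℝ) proj x := hproj.mdifferentiableAt (by simp)
  have hg := (contMDiffAt_metricInChart g x).mdifferentiableAt (by simp)
  have hPd := mdifferentiableAt_fieldInChart
    ((ContMDiffAt.riemannianGradient g hproj).mdifferentiableAt (by simp))
  have hud : MDifferentiableAt I 𝓘(ℝ, ℝ) u x := hf.mdifferentiableAt.comp x hpd
  have hf'd : MDifferentiableAt I 𝓘(ℝ, ℝ) (fun z => deriv f (proj z)) x :=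
    hf'.mdifferentiableAt.comp x hpd
  have hφ_fun : φ = fun z => φhat (proj z) := funext hφeq
  have hφd : MDifferentiableAt I 𝓘(ℝ, ℝ) φ x := by
    rw [hφ_fun]
    exact hφhat.mdifferentiableAt.comp x hpd
  have hX₂d : MDifferentiableAt I 𝓘(ℝ, ℝ) X₂ x := mdifferentiableAt_graphSnd hud hν
  have hφX₂ : MDifferentiableAt I 𝓘(ℝ, ℝ) (fun z => φ z * X₂ z) x := hφd.mul hX₂d
  have hφX₂f : MDifferentiableAt I 𝓘(ℝ, ℝ) (fun z => φ z * X₂ z * deriv f (proj z)) x :=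
    hφX₂.mul hf'd
  have hdφ : ∀ v, mvfderiv I φ x v = deriv φhat (proj x) * mvfderiv I proj x v := fun v => by
    rw [hφ_fun]
    exact mvfderiv_real_comp_apply hφhat hpd v
  have hdu : mvfderiv I u x w = deriv f (proj x) * mvfderiv I proj x w :=
    mvfderiv_real_comp_apply hf hpd w
  have hPw : ∀ v, g.inner x (P x) v = mvfderiv I proj x v :=
    inner_riemannianGradient g.toRiemannianMetric proj x
  have hX1field : fieldInChart I x (graphFst u ν) =ᶠ[𝓝 x]
      fun z => (-(φ z * X₂ z * deriv f (proj z))) • fieldInChart I x P z := by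
    filter_upwards [hX] with z hz
    rw [fieldInChart, hz, map_smul]
    rfl
  have hfield : mvfderiv I (fieldInChart I x (graphFst u ν)) x w =
      (-(φ x * X₂ x * deriv f (proj x))) • mvfderiv I (fieldInChart I x P) x w
      - ((φ x * X₂ x * (deriv (deriv f) (proj x) * mvfderiv I proj x w)
        + deriv f (proj x) * (φ x * mvfderiv I X₂ x w
          + X₂ x * (deriv φhat (proj x) * mvfderiv I proj x w)))) • fieldInChart I x P x := by
    have hneg : MDifferentiableAt I 𝓘(ℝ, ℝ) (fun z => -(φ z * X₂ z * deriv f (proj z))) x :=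
      hφX₂f.neg
    rw [mvfderiv_congr_of_eventuallyEq hX1field, mvfderiv_fun_smul hneg hPd,
      mvfderiv_fun_neg, mvfderiv_fun_mul hφX₂ hf'd, mvfderiv_fun_mul hφd hX₂d]
    have := mvfderiv_real_comp_apply hf' hpd w
    simp [this, hdφ]
    module
  have hX1 := hX.self_of_nhds
  have hmain := leviCivita_warpedMetric_graph (g := g.toRiemannianMetric) hud hν hφ hg hφd w
  rw [hdu] at hmain
  refine hmain.trans ?_
  rw [hfield, hX1, fieldInChart_self, nablaForm_apply]
  -- The identity in the model space `E`, where all terms are plain vectors and forms.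
  have key : ∀ (D : E →L[ℝ] E →L[ℝ] E →L[ℝ] ℝ) (G : E →L[ℝ] E →L[ℝ] ℝ) (L L' : E →L[ℝ] ℝ)
      (y v a : E) (d f' f'' φ₀ x₂ d₂ : ℝ), (∀ v, L' v = d * L v) → G y v = L v → L y = c →
      φ₀ ≠ 0 →
      1 / 2 * (D (-(φ₀ * x₂ * f') • y) v v + L' (-(φ₀ * x₂ * f') • y) * (f' * L v * (f' * L v)))
        + (G (-(φ₀ * x₂ * f') • a
            - (φ₀ * x₂ * (f'' * L v) + f' * (φ₀ * d₂ + x₂ * (d * L v))) • y) v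
          + φ₀ * (d₂ * (f' * L v))) =
        -(φ₀ * x₂) * (f' * (1 / 2 * D y v v + G a v)
          + (f'' + d * f' ^ 3 * c / 2 + d * f' / φ₀) * (L v * L v)) := by
    intro D G L L' y v a d f' f'' φ₀ x₂ d₂ h1 h2 h3 h0
    simp only [h1, map_smul, map_sub, map_neg, neg_smul, smul_apply, neg_apply, sub_apply,
      smul_eq_mul, h2, h3]
    field_simp
    ring
  exact key (mvfderiv I (metricInChart g.toRiemannianMetric x) x) (g.inner x)
    (mvfderiv I proj x) (mvfderiv I φ x) (P x) w (mvfderiv I (fieldInChart I x P) x w)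
    _ _ _ _ _ (mvfderiv I X₂ x w) hdφ (hPw w) ((hPw (P x)).symm.trans hPP) (hφ x).ne'

end MeanCurvature

/-! ### The soliton equation at a point -/

section SolitonEquation

variable {E : Type*} [NormedAddCommGroup E] [NormedSpace ℝ E] [FiniteDimensional ℝ E]
  {H : Type*} [TopologicalSpace H] {I : ModelWithCorners ℝ E H}
  {M : Type*} [TopologicalSpace M] [ChartedSpace H M]

/-- The component along `M` of a unit normal field along the graph of `f ∘ proj` is a multiple of
the gradient of `proj`, near the point in question and not only at it, so that it may be
differentiated. -/
theorem IsLocalUnitNormal.graphFst_eventuallyEq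
    {g : RiemannianMetric (fun x : M => TangentSpace I x)}
    {φ : M → ℝ} {hφ : ∀ x, 0 < φ x} {proj : M → ℝ} {f : ℝ → ℝ} {J' : Set ℝ} {x : M}
    [IsManifold I 1 M]
    (hproj : MDifferentiable I 𝓘(ℝ, ℝ) proj) (hJ' : IsOpen J') (hf : DifferentiableOn ℝ f J')
    (hx : proj x ∈ J') {ν : Π p : M × ℝ, TangentSpace (I.prod 𝓘(ℝ, ℝ)) p}
    (hν : IsLocalUnitNormal I (warpedMetric g φ hφ) (fun z => (z, f (proj z))) x ν) :
    ∀ᶠ z in 𝓝 x, graphFst (fun z => f (proj z)) ν z =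
      (-(φ z * graphSnd (fun z => f (proj z)) ν z * deriv f (proj z))) •
        riemannianGradient g proj z := by
  filter_upwards [hν.normal, (hproj x).continuousAt.preimage_mem_nhds (hJ'.mem_nhds hx)]
    with z hz hzJ
  have hfz : DifferentiableAt ℝ f (proj z) := hf.differentiableAt (hJ'.mem_nhds hzJ)
  exact graphFst_eq_smul_gradient hφ (u := fun z => f (proj z))
    (hfz.mdifferentiableAt.comp z (hproj z)) (fun w => mvfderiv_real_comp_apply hfz (hproj z) w) hz

/-- The algebra behind the equivalence of the soliton equation with the differential equation for
the profile `f`: here `b = g(K, ν)`, `t` is the trace of `∇(∇proj)`,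
`a` is the value of `α`, and `hb` expresses that `ν` has norm one. -/
theorem soliton_algebra {a φ h t b f' f'' α' φ' : ℝ} (ha : 0 < a) (hφ : 0 < φ)
    (hb : b ^ 2 * (f' ^ 2 / a + 1 / φ) = 1) (hh : h = √a * (t + α' / (2 * a ^ 2))) :
    b * (f' * t + (f'' + φ' * f' ^ 3 * a⁻¹ / 2 + φ' * f' / φ) * a⁻¹)
        - b * (f' * (-α' / (2 * a ^ 3)) + (f'' + φ' * f' ^ 3 * a⁻¹ / 2 + φ' * f' / φ) * (a⁻¹ * a⁻¹))
          * (b ^ 2 * f' ^ 2) = b ↔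
      f'' = (a + φ * f' ^ 2) * (1 - φ' * f' / (2 * φ * a) - f' * h / √a)
        + f' / 2 * (α' / a - φ' / φ) := by
  have hb0 : b ≠ 0 := by rintro rfl; norm_num at hb
  have hs := Real.sqrt_pos.2 ha
  have hW : 0 < a + φ * f' ^ 2 := by positivity
  have hb2 : b ^ 2 = a * φ / (a + φ * f' ^ 2) := by
    field_simp at hb ⊢
    linarith
  have ht : f' * h / √a = f' * (t + α' / (2 * a ^ 2)) := by
    rw [hh]; field_simp
  rw [ht, hb2, mul_assoc b, ← mul_sub]
  rw [mul_eq_left₀ hb0]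
  field_simp
  constructor <;> intro h <;> linarith

variable [IsManifold I ∞ M]

set_option synthInstance.maxHeartbeats 200000 in
/-- At each point of the graph of `f ∘ proj`, and for each unit normal field, the soliton equation
is equivalent to the differential equation for `f`. -/
theorem IsSubmersive.meanCurvature_graph_eq_iff
    {g : ContMDiffRiemannianMetric I ∞ E (fun x : M => TangentSpace I x)}
    {φ : M → ℝ} {hφ : ∀ x, 0 < φ x} {proj : M → ℝ} {J : Set ℝ} {α φhat h : ℝ → ℝ}
    (hsub : IsSubmersive g.toRiemannianMetric φ proj J α φhat h)
    {J' : Set ℝ} (hJ'_open : IsOpen J') (hJ' : J' ⊆ J) {f : ℝ → ℝ} (hf : ContDiffOn ℝ ∞ f J')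
    {x : M} (hx : proj x ∈ J') {ν : Π p : M × ℝ, TangentSpace (I.prod 𝓘(ℝ, ℝ)) p}
    (hν : IsLocalUnitNormal I (warpedMetric g.toRiemannianMetric φ hφ)
      (fun z => (z, f (proj z))) x ν) :
    meanCurvature (warpedMetric g.toRiemannianMetric φ hφ) ν (x, f (proj x)) =
        (warpedMetric g.toRiemannianMetric φ hφ).inner (x, f (proj x))
          (killingField I (x, f (proj x))) (ν (x, f (proj x))) ↔
      deriv (deriv f) (proj x) =
        (α (proj x) + φhat (proj x) * deriv f (proj x) ^ 2)
            * (1 - deriv φhat (proj x) * deriv f (proj x) / (2 * φhat (proj x) * α (proj x))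
              - deriv f (proj x) * h (proj x) / √(α (proj x)))
          + deriv f (proj x) / 2 * deriv (fun t => Real.log (α t / φhat t)) (proj x) := by
  have hproj := hsub.submersion
  have hnhds : J' ∈ 𝓝 (proj x) := hJ'_open.mem_nhds hx
  have hJn : J ∈ 𝓝 (proj x) := mem_of_superset hnhds hJ'
  have hα : DifferentiableAt ℝ α (proj x) :=
    (hsub.alpha_smooth.contDiffAt hJn).differentiableAt (by simp)
  have hφhat : DifferentiableAt ℝ φhat (proj x) :=
    (hsub.phi_smooth.contDiffAt hJn).differentiableAt (by simp)
  have hfd : DifferentiableAt ℝ f (proj x) := (hf.contDiffAt hnhds).differentiableAt (by simp)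
  have hf' : DifferentiableAt ℝ (deriv f) (proj x) :=
    ((hf.deriv_of_isOpen (m := ∞) hJ'_open (by simp)).contDiffAt hnhds).differentiableAt (by simp)
  have hα0 := hsub.alpha_pos _ (hJ' hx)
  have hφ0 : 0 < φhat (proj x) := hsub.phi_eq x ▸ hφ x
  have hlog : deriv (fun t => Real.log (α t / φhat t)) (proj x) =
      deriv α (proj x) / α (proj x) - deriv φhat (proj x) / φhat (proj x) := by
    rw [deriv.log (hα.fun_div hφhat hφ0.ne') (div_pos hα0 hφ0).ne', deriv_fun_div hα hφhat hφ0.ne']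
    field_simp
  set P := riemannianGradient g.toRiemannianMetric proj with hP
  have hPP : g.inner x (P x) (P x) = (α (proj x))⁻¹ := hproj.inner_gradient_self x
  have hPw : ∀ w, g.inner x (P x) w = mvfderiv I proj x w :=
    inner_riemannianGradient g.toRiemannianMetric proj x
  have hX := hν.graphFst_eventuallyEq (hproj.smooth.mdifferentiable (by simp)) hJ'_open
    (hf.differentiableOn (by simp)) hx
  have hX1 := hX.self_of_nhds
  set X₂ := graphSnd (fun z => f (proj z)) ν x with hX₂
  set d := deriv f (proj x) with hd
  set κ := deriv (deriv f) (proj x) + deriv φhat (proj x) * d ^ 3 * (α (proj x))⁻¹ / 2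
    + deriv φhat (proj x) * d / φ x with hκ
  have hXX : g.inner x (graphFst (fun z => f (proj z)) ν x) (graphFst (fun z => f (proj z)) ν x)
      = (φ x * X₂ * d) ^ 2 * (α (proj x))⁻¹ := by
    rw [hX1]
    change g.inner x ((-(φ x * X₂ * d)) • P x) ((-(φ x * X₂ * d)) • P x) = _
    simp [hPP]
    ring
  have hunit := hν.unit.self_of_nhds
  have hb : (φ x * X₂) ^ 2 * (d ^ 2 / α (proj x) + 1 / φ x) = 1 := by
    have h1 := inner_warpedMetric_graph_self g.toRiemannianMetric φ hφ (fun z => f (proj z)) ν x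
    rw [hunit] at h1
    have h2 : (1 : ℝ) = (φ x * X₂ * d) ^ 2 * (α (proj x))⁻¹ + φ x * (X₂ * X₂) :=
      h1.trans (congrArg (· + φ x * (X₂ * X₂)) hXX)
    have := (hφ x).ne'
    refine Eq.trans ?_ h2.symm
    field_simp
  -- The graph is nowhere vertical, so the orthogonality relation below can be solved for `a`.
  have hX₂0 : X₂ ≠ 0 := by
    intro h0
    rw [h0] at hb
    norm_num at hb
  let T : TangentSpace I x →L[ℝ] TangentSpace I x →L[ℝ] ℝ :=
    d • nablaForm g.toRiemannianMetric P x + κ • (g.inner x (P x)).smulRight (g.inner x (P x))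
  have hS : ∀ v : TangentSpace (I.prod 𝓘(ℝ, ℝ)) (x, f (proj x)),
      (warpedMetric g.toRiemannianMetric φ hφ).inner (x, f (proj x)) (ν (x, f (proj x))) v = 0 →
      -leviCivita (warpedMetric g.toRiemannianMetric φ hφ) v ν v =
        ((φ x * X₂) • T) (v : E × ℝ).1 (v : E × ℝ).1 := by
    rintro ⟨w, a⟩ hv
    have h1 := inner_warpedMetric_graph g.toRiemannianMetric φ hφ (fun z => f (proj z)) ν x w a
    have h2 : g.inner x (graphFst (fun z => f (proj z)) ν x) w =
        -(φ x * X₂ * d) * mvfderiv I proj x w := by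
      rw [hX1, ← hPw w]
      exact congrArg (fun L : TangentSpace I x →L[ℝ] ℝ => L w)
        (map_smul (g.inner x) (-(φ x * X₂ * d)) (P x))
    have h3 : -(φ x * X₂ * d) * mvfderiv I proj x w + φ x * (X₂ * a) = 0 :=
      (congrArg (· + φ x * (X₂ * a)) h2).symm.trans (h1.symm.trans hv)
    have ha : a = d * mvfderiv I proj x w := by
      have h4 : φ x * X₂ * (a - d * mvfderiv I proj x w) = 0 := by linarith
      exact sub_eq_zero.1 ((mul_eq_zero.1 h4).resolve_left (mul_ne_zero (hφ x).ne' hX₂0))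
    subst ha
    refine (congrArg Neg.neg (leviCivita_warpedMetric_graph_comp hφ (hproj.smooth x) hφhat
      hsub.phi_eq hfd hf' hPP (hν.smooth.mdifferentiableAt (by simp)) hX w)).trans ?_
    refine Eq.trans ?_ (congrArg (fun s : ℝ => φ x * X₂ *
      (d * nablaForm g.toRiemannianMetric P x w w + κ * (s * s))) (hPw w)).symm
    exact (by intros; ring : ∀ b z : ℝ, -(-b * z) = b * z) _ _
  have hH := meanCurvature_eq_metricTrace (warpedMetric g.toRiemannianMetric φ hφ)
    g.toRiemannianMetric ν (x, f (proj x)) x (ContinuousLinearMap.fst ℝ E ℝ)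
    (fun w => ((w, 0) : E × ℝ)) (fun w v => ?_) (fun w => rfl) ((φ x * X₂) • T) hS
  · have hK : (warpedMetric g.toRiemannianMetric φ hφ).inner (x, f (proj x))
        (killingField I (x, f (proj x))) (ν (x, f (proj x))) = φ x * X₂ := by
      rw [killingField_eq]
      change g.inner x (0 : E) (graphFst (fun z => f (proj z)) ν x) + φ x * (1 * X₂) = _
      have h0 : g.inner x (0 : E) = 0 := map_zero _
      rw [h0]
      simp
    have hTX : T (graphFst (fun z => f (proj z)) ν x) (graphFst (fun z => f (proj z)) ν x) =
        (d * (-(deriv α (proj x)) / (2 * α (proj x) ^ 3))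
          + κ * ((α (proj x))⁻¹ * (α (proj x))⁻¹)) * ((φ x * X₂) ^ 2 * d ^ 2) := by
      have hn := hproj.nablaForm_gradient_self hα hα0.ne'
      have hTP : T (P x) (P x) = d * (-(deriv α (proj x)) / (2 * α (proj x) ^ 3))
          + κ * ((α (proj x))⁻¹ * (α (proj x))⁻¹) := by
        rw [← hn, ← hPP]
        rfl
      rw [hX1, ← hTP]
      change T ((-(φ x * X₂ * d)) • P x) ((-(φ x * X₂ * d)) • P x) = _
      simp only [map_smul, smul_apply, smul_eq_mul]
      ring
    rw [hunit, div_one] at hH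
    have htr : metricTrace g.toRiemannianMetric x ((φ x * X₂) • T) = φ x * X₂ *
        (d * metricTrace g.toRiemannianMetric x (nablaForm g.toRiemannianMetric P x)
          + κ * (α (proj x))⁻¹) := by
      rw [metricTrace_smul, metricTrace_add, metricTrace_smul, metricTrace_smul, ← hPP]
      exact congrArg (fun s => φ x * X₂ * (d * metricTrace g.toRiemannianMetric x
        (nablaForm g.toRiemannianMetric P x) + κ * s))
        (metricTrace_smulRight g.toRiemannianMetric x (P x))
    have hH' : meanCurvature (warpedMetric g.toRiemannianMetric φ hφ) ν (x, f (proj x)) =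
        φ x * X₂ * (d * metricTrace g.toRiemannianMetric x (nablaForm g.toRiemannianMetric P x)
          + κ * (α (proj x))⁻¹)
        - φ x * X₂ * ((d * (-(deriv α (proj x)) / (2 * α (proj x) ^ 3))
          + κ * ((α (proj x))⁻¹ * (α (proj x))⁻¹)) * ((φ x * X₂) ^ 2 * d ^ 2)) := by
      rw [← htr, ← hTX]
      exact hH
    rw [hH', hK, hlog, hκ, ← mul_assoc (φ x * X₂) _ ((φ x * X₂) ^ 2 * d ^ 2), ← hsub.phi_eq x]
    exact soliton_algebra hα0 (hφ x) hb (hsub.fibre_meanCurvature_eq hα)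
  -- `w ↦ (w, 0)` is adjoint to the projection
  · change g.inner x w (v : E × ℝ).1 + φ x * (0 * (v : E × ℝ).2) = g.inner x w (v : E × ℝ).1
    ring

end SolitonEquation

/-! ### Existence of unit normal fields, and the equivalence -/

section Existence

variable {E : Type*} [NormedAddCommGroup E] [NormedSpace ℝ E]
  {H : Type*} [TopologicalSpace H] {I : ModelWithCorners ℝ E H}
  {M : Type*} [TopologicalSpace M] [ChartedSpace H M] [IsManifold I ∞ M]

/-- A smooth vector field `Y` and a smooth function `b` on `M` define a smooth vector field on `M ×
ℝ` that is invariant under translations of `ℝ`. -/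
theorem ContMDiffAt.prodMk_section {Y : Π x : M, TangentSpace I x} {b : M → ℝ} {x : M}
    (hY : ContMDiffAt I I.tangent ∞ (fun z => (⟨z, Y z⟩ : TangentBundle I M)) x)
    (hb : ContMDiffAt I 𝓘(ℝ, ℝ) ∞ b x) (r : ℝ) :
    ContMDiffAt (I.prod 𝓘(ℝ, ℝ)) (I.prod 𝓘(ℝ, ℝ)).tangent ∞
      (fun q => (⟨q, ((Y q.1, b q.1) : E × ℝ)⟩ : TangentBundle (I.prod 𝓘(ℝ, ℝ)) (M × ℝ)))
      (x, r) := by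
  have hY' : ContMDiffAt I 𝓘(ℝ, E) ∞ (fieldInChart I x Y) x := by
    refine ((Bundle.contMDiffAt_section x).1 hY).congr_of_eventuallyEq ?_
    filter_upwards [chart_source_mem_nhds H x] with q hq
    exact (trivializationAt E (TangentSpace I) x).continuousLinearMapAt_apply_of_mem ℝ hq (Y q)
  have hfst : ContMDiffAt (I.prod 𝓘(ℝ, ℝ)) I ∞ (Prod.fst : M × ℝ → M) (x, r) := contMDiffAt_fst
  refine contMDiffAt_section_of_fieldInChart (ContMDiffAt.congr_of_eventuallyEq
    ((ContMDiffAt.comp (x, r) hY' hfst).prodMk_space (ContMDiffAt.comp (x, r) hb hfst)) ?_)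
  filter_upwards [continuous_fst.continuousAt.preimage_mem_nhds
    (chart_source_mem_nhds H (x, r).1)] with q hq
  exact continuousLinearMapAt_trivializationAt_prod_real (I := I) x r hq _ _

variable [FiniteDimensional ℝ E]

/-- The graph of `f ∘ proj` has a smooth unit normal field near each of its points. It is
`W⁻¹ (-f' ∇proj, 1 / φ)` with `W² = f'² / α + 1 / φ`, extended independently of the second
coordinate. -/
theorem IsSubmersive.exists_isLocalUnitNormal_graph
    {g : ContMDiffRiemannianMetric I ∞ E (fun x : M => TangentSpace I x)}
    {φ : M → ℝ} (hφ : ∀ x, 0 < φ x) (hφ_smooth : ContMDiff I 𝓘(ℝ, ℝ) ∞ φ)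
    {proj : M → ℝ} {J : Set ℝ} {α φhat h : ℝ → ℝ}
    (hsub : IsSubmersive g.toRiemannianMetric φ proj J α φhat h)
    {J' : Set ℝ} (hJ'_open : IsOpen J') (hJ' : J' ⊆ J) {f : ℝ → ℝ} (hf : ContDiffOn ℝ ∞ f J')
    {x : M} (hx : proj x ∈ J') :
    ∃ ν : Π p : M × ℝ, TangentSpace (I.prod 𝓘(ℝ, ℝ)) p,
      IsLocalUnitNormal I (warpedMetric g.toRiemannianMetric φ hφ)
        (fun z => (z, f (proj z))) x ν := by
  have hproj := hsub.submersion
  have hnhds : J' ∈ 𝓝 (proj x) := hJ'_open.mem_nhds hx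
  have hnhdsM : ∀ᶠ z in 𝓝 x, proj z ∈ J' :=
    hproj.smooth.continuous.continuousAt.preimage_mem_nhds hnhds
  have hpos : ∀ z, 0 < deriv f (proj z) ^ 2 * (α (proj z))⁻¹ + (φ z)⁻¹ := fun z => by
    have := hsub.alpha_pos (proj z) (hproj.range_eq ▸ mem_range_self z)
    have := hφ z
    positivity
  have hf' : ContMDiffAt I 𝓘(ℝ, ℝ) ∞ (fun z => deriv f (proj z)) x :=
    (((hf.deriv_of_isOpen (m := ∞) hJ'_open (by simp)).contDiffAt hnhds).contMDiffAt).comp x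
      (hproj.smooth x)
  have hα : ContMDiffAt I 𝓘(ℝ, ℝ) ∞ (fun z => (α (proj z))⁻¹) x :=
    (((hsub.alpha_smooth.contDiffAt (mem_of_superset hnhds hJ')).inv
      (hsub.alpha_pos _ (hJ' hx)).ne').contMDiffAt).comp x (hproj.smooth x)
  have hφi : ContMDiffAt I 𝓘(ℝ, ℝ) ∞ (fun z => (φ z)⁻¹) x :=
    ((contDiffAt_inv ℝ (hφ x).ne').contMDiffAt).comp x (hφ_smooth x)
  have hw : ContMDiffAt I 𝓘(ℝ, ℝ) ∞
      (fun z => deriv f (proj z) ^ 2 * (α (proj z))⁻¹ + (φ z)⁻¹) x :=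
    ((hf'.pow 2).mul hα).add hφi
  have hW : ContMDiffAt I 𝓘(ℝ, ℝ) ∞
      (fun z => (√(deriv f (proj z) ^ 2 * (α (proj z))⁻¹ + (φ z)⁻¹))⁻¹) x :=
    ContMDiffAt.comp (g := fun s : ℝ => (√s)⁻¹) x
      (((Real.contDiffAt_sqrt (hpos x).ne').inv (Real.sqrt_pos.2 (hpos x)).ne').contMDiffAt) hw
  set P := riemannianGradient g.toRiemannianMetric proj with hP
  set W : M → ℝ := fun z => √(deriv f (proj z) ^ 2 * (α (proj z))⁻¹ + (φ z)⁻¹) with hWdef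
  have hW0 : ∀ z, W z ≠ 0 := fun z => (Real.sqrt_pos.2 (hpos z)).ne'
  have hW2 : ∀ z, W z ^ 2 = deriv f (proj z) ^ 2 * (α (proj z))⁻¹ + (φ z)⁻¹ := fun z =>
    Real.sq_sqrt (hpos z).le
  refine ⟨fun q => (((-((W q.1)⁻¹ * deriv f (proj q.1))) • P q.1, (W q.1)⁻¹ * (φ q.1)⁻¹) : E × ℝ),
    ?_, ?_, ?_⟩
  · exact ((hW.mul hf').neg.smul_section
      (ContMDiffAt.riemannianGradient g (hproj.smooth x))).prodMk_section (hW.mul hφi) _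
  · refine Eventually.of_forall fun z => ?_
    have h1 : g.inner z (-((W z)⁻¹ * deriv f (proj z)) • P z)
        (-((W z)⁻¹ * deriv f (proj z)) • P z) =
        ((W z)⁻¹ * deriv f (proj z)) ^ 2 * (α (proj z))⁻¹ := by
      have hPP : g.inner z (P z) (P z) = _ := hproj.inner_gradient_self z
      simp [hPP]
      ring
    change g.inner z (-((W z)⁻¹ * deriv f (proj z)) • P z)
      (-((W z)⁻¹ * deriv f (proj z)) • P z)
      + φ z * ((W z)⁻¹ * (φ z)⁻¹ * ((W z)⁻¹ * (φ z)⁻¹)) = 1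
    rw [h1]
    have h2 : φ z * ((W z)⁻¹ * (φ z)⁻¹ * ((W z)⁻¹ * (φ z)⁻¹)) = (W z)⁻¹ ^ 2 * (φ z)⁻¹ := by
      have := (hφ z).ne'
      field_simp
    rw [h2, mul_pow, mul_assoc, ← mul_add, ← hW2 z, ← mul_pow, inv_mul_cancel₀ (hW0 z), one_pow]
  · filter_upwards [hnhdsM] with z hz w
    have hfz : DifferentiableAt ℝ f (proj z) :=
      (hf.contDiffAt (hJ'_open.mem_nhds hz)).differentiableAt (by simp)
    have hpz : MDifferentiableAt I 𝓘(ℝ, ℝ) proj z := (hproj.smooth z).mdifferentiableAt (by simp)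
    rw [mfderiv_graph_apply (u := fun z => f (proj z)) (hfz.mdifferentiableAt.comp z hpz)]
    have h1 : g.inner z (-((W z)⁻¹ * deriv f (proj z)) • P z) w =
        -((W z)⁻¹ * deriv f (proj z)) * mvfderiv I proj z w := by
      rw [← inner_riemannianGradient g.toRiemannianMetric proj z w]
      exact congrArg (fun L : TangentSpace I z →L[ℝ] ℝ => L w)
        (map_smul (g.inner z) (-((W z)⁻¹ * deriv f (proj z))) (P z))
    change g.inner z (-((W z)⁻¹ * deriv f (proj z)) • P z) w
      + φ z * ((W z)⁻¹ * (φ z)⁻¹ * mvfderiv I (fun z => f (proj z)) z w) = 0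
    rw [h1, mvfderiv_real_comp_apply hfz hpz w]
    have := (hφ z).ne'
    field_simp
    ring

end Existence

end

theorem mainTheorem1 {n : ℕ} {M : Type*} [TopologicalSpace M]
    [ChartedSpace (EuclideanSpace ℝ (Fin n)) M] [IsManifold (𝓡 n) ∞ M]
    (g : ContMDiffRiemannianMetric (𝓡 n) ∞ (EuclideanSpace ℝ (Fin n))
      (fun x : M => TangentSpace (𝓡 n) x))
    (φ : M → ℝ) (hφ : ∀ x, 0 < φ x) (hφ_smooth : ContMDiff (𝓡 n) 𝓘(ℝ, ℝ) ∞ φ)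
    (I : Set ℝ) (hI : I.OrdConnected)
    (proj : M → ℝ) (J : Set ℝ) (α φhat h : ℝ → ℝ)
    (hsub : IsSubmersive g.toRiemannianMetric φ proj J α φhat h)
    (J' : Set ℝ) (hJ'_open : IsOpen J') (hJ'_ord : J'.OrdConnected) (hJ' : J' ⊆ J)
    (f : ℝ → ℝ) (hf : ContDiffOn ℝ ∞ f J') (hfI : ∀ s ∈ J', f s ∈ I) :
    IsGraphSoliton g.toRiemannianMetric φ hφ (proj ⁻¹' J') (fun x => f (proj x)) ↔
      ∀ s ∈ J', deriv (deriv f) s =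
        (α s + φhat s * deriv f s ^ 2)
            * (1 - deriv φhat s * deriv f s / (2 * φhat s * α s) - deriv f s * h s / √(α s))
          + deriv f s / 2 * deriv (fun t => Real.log (α t / φhat t)) s := by
  constructor
  · intro hsol s hs
    obtain ⟨x, rfl⟩ : s ∈ range proj := hsub.submersion.range_eq ▸ hJ' hs
    obtain ⟨ν, hν⟩ :=
      hsub.exists_isLocalUnitNormal_graph hφ hφ_smooth hJ'_open hJ' hf (x := x) hs
    exact (hsub.meanCurvature_graph_eq_iff hJ'_open hJ' hf hs hν).1 (hsol x hs ν hν)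
  · intro hode x hx ν hν
    exact (hsub.meanCurvature_graph_eq_iff hJ'_open hJ' hf hx hν).2 (hode (proj x) hx)
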